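/- **Setting.** A stream over $d$ topics consists of triples $(V_i,p_i,\tau_i)$, $i=1,\dots,N$, where $V_i\subseteq\{c_1,\dots,c_d\}$ is an item, $p_i\in[0,1]$ its click probability, and $\tau_i\in\{0,1\}$ tells whether the user accesses the system at time $i$. Let $r_1<\dots<r_T$ be the times with $\tau_i=1$. A *feasible solution* is a sequence $S^1,\dots,S^T$ with $S^t\subseteq\{V_1,\dots,V_{r_t}\}$ and $|S^t|\le k$. Occurrences of an item in different sets count as different copies, and for a set $X$ of copies $$f(X)=\sum_{j=1}^d\Bigl(1-\prod_{V_i\in X,\ c_j\in V_i}(1-p_i)\Bigr)$$ (one factor for each copy) is the expected number of covered topics. Write $f(X\mid Y)=f(X\cup Y)-f(Y)$. The parameters are integers $k\ge 1$, $\delta\ge 1$ and an upper bound $T'\ge T$. **Storm($g$)** keeps candidate sets $A^1,\dots,A^g$, all empty and active at first, regarded as sets of copies that are distinct for distinct $j$. When $V_i$ arrives, it is offered to the active sets $A^j$ in increasing order of $j$. If $|A^j|<k$, then $V_i$ is added to $A^j$. Otherwise let $V'\in A^j$ minimize $\nu(V')=f(V'\mid\{\text{copies in }\bigcup_qA^q\text{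 added before }V'\})$; if $f(V_i\mid\bigcup_{q}A^q)\ge 2\nu(V')$, then $V_i$ replaces $V'$ in $A^j$. If $\tau_i=1$, Storm($g$) then outputs an active $A^j$ with largest $f(A^j\mid\text{union of the sets output before})$ and makes it inactive; it outputs $\emptyset$ if no set is active. **Storm++** runs Storm($g$) for every $g\in\{\delta,2\delta,\dots,\lceil T'/\delta\rceil\delta\}$. At the $t$-th access it presents as $H^t$ one of the sets that these copies of Storm output at this access, namely one with largest $f(\,\cdot\mid H^1\cup\dots\cup H^{t-1})$. Ties are broken arbitrarily. **Complexity measures.** Time is the number of evaluations of $f$ (oracle calls) over the whole stream. The response time is the number of successive oracle calls between a request and its answer, where the copies of Storm run in parallel: the largest number of calls that any single copy makes to choose its output, plus the number of calls for the choice among the outputs. Space is the number of memory words (a name and a probability for each stored item, flags, counters, and oracle answers held within a time step). **Theorem.** The sequence $H^1,\dots,H^T$ presented by Storm++ is a feasible solution, and Storm++ is $\frac1{8\delta}$-competitive: $$f(H^1\cup\dots\cup H^T)\ \ge\ \frac1{8\delta}\,f(O^1\cup\dots\cup O^T)\quad\text{for every feasible solution }O^1,\dots,O^T.$$ Moreover,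 if $\delta\le T'$, then Storm++ has space complexity $\mathcal O(T'^2k/\delta)$, time complexity $\mathcal O(NkT'^2/\delta)$ and response time $\mathcal O(T')$, with absolute constants. -/

import Mathlib

namespace S3MOR

/-! ### Streams, objective, feasible solutions -/

/-- A stream of `N` news items over `d` topics: item `i` arrives at time step `i`, covers the topics
`topics i`, is clicked with probability `prob i` each time it is presented, and `access i` tells
whether the user accesses the system at time step `i`. -/
structure NewsStream (d N : ℕ) where
  topics : Fin N → Finset (Fin d)
  prob : Fin N → ℝ
  prob_mem : ∀ i, prob i ∈ Set.Icc (0 : ℝ) 1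
  access : Fin N → Bool

/-- The set of copies `(v, q)`, for `q ∈ I` and `v ∈ A q`: the union of the sets `A q`, with the
occurrences of one item in different sets kept apart as different copies. -/
def copies {ι : Type} [DecidableEq ι] (I : Finset ℕ) (A : ℕ → Finset ι) : Finset (ι × ℕ) :=
  I.biUnion fun q => A q ×ˢ {q}

namespace NewsStream

variable {d N : ℕ}

/-- The objective: the expected number of topics covered by the clicks of the user when the copies
in `X` are presented, each copy being clicked independently with the probability of its item. -/
noncomputable def coverage (S : NewsStream d N) (X : Finset (Fin N × ℕ)) : ℝ :=
  ∑ c : Fin d, (1 - ∏ x ∈ X with c ∈ S.topics x.1, (1 - S.prob x.1))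

/-- The number `T` of user accesses. -/
def numVisits (S : NewsStream d N) : ℕ :=
  (Finset.univ.filter fun i => S.access i = true).card

/-- Time step `r` is the one of the `t`-th access (`t = 1, 2, …`). -/
def IsVisit (S : NewsStream d N) (t : ℕ) (r : Fin N) : Prop :=
  S.access r = true ∧ (Finset.univ.filter fun i => i ≤ r ∧ S.access i = true).card = t

/-- `A 1, …, A T` is a feasible (offline) solution: at the `t`-th access at most `k` items are
presented, all of which have arrived by then. -/
def Feasible (S : NewsStream d N) (k : ℕ) (A : ℕ → Finset (Fin N)) : Prop :=
  ∀ t ∈ Finset.Icc 1 S.numVisits,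
    (A t).card ≤ k ∧ ∀ i ∈ A t, ∃ r, S.IsVisit t r ∧ i ≤ r

/-- The value of the solution `A 1, …, A T`. -/
noncomputable def value (S : NewsStream d N) (A : ℕ → Finset (Fin N)) : ℝ :=
  S.coverage (copies (Finset.Icc 1 S.numVisits) A)

end NewsStream

/-! ### Programs with access to a value oracle -/

/-- Programs that can query a real-valued oracle on inputs from `Q`. -/
inductive OracleProg (Q α : Type) : Type where
  | done (a : α) : OracleProg Q α
  | query (q : Q) (next : ℝ → OracleProg Q α) : OracleProg Q α

namespace OracleProg

variable {Q α β : Type}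

def bind : OracleProg Q α → (α → OracleProg Q β) → OracleProg Q β
  | done a, h => h a
  | query q next, h => query q fun x => bind (next x) h

instance : Monad (OracleProg Q) where
  pure := done
  bind := bind

/-- A single oracle call. -/
def ask (q : Q) : OracleProg Q ℝ := query q done

/-- Runs a program with oracle `f`; returns the result and the number of oracle calls made. -/
def run (f : Q → ℝ) : OracleProg Q α → α × ℕ
  | done a => (a, 0)
  | query q next => ((run f (next (f q))).1, (run f (next (f q))).2 + 1)

/-- Evaluates `val` on each entry of a list. -/
def evalAll (val : β → OracleProg Q ℝ) : List β → OracleProg Q (List (β × ℝ))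
  | [] => pure []
  | c :: cs => do
    let x ← val c
    let L ← evalAll val cs
    pure ((c, x) :: L)

/-- An entry of `cs` with the largest value; `pick` chooses among the maximizers. -/
noncomputable def argmax [DecidableEq β] (pick : Finset β → β) (cs : List β)
    (val : β → OracleProg Q ℝ) : OracleProg Q β := do
  let L ← evalAll val cs
  pure (pick ((L.filter fun x => ∀ y ∈ L, y.2 ≤ x.2).map Prod.fst).toFinset)

/-- An entry of `cs` with the smallest value; `pick` chooses among the minimizers. -/
noncomputable def argmin [DecidableEq β] (pick : Finset β → β) (cs : List β)
    (val : β → OracleProg Q ℝ) : OracleProg Q β := do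
  let L ← evalAll val cs
  pure (pick ((L.filter fun x => ∀ y ∈ L, x.2 ≤ y.2).map Prod.fst).toFinset)

end OracleProg

/-- The incremental gain `f (X ∣ Y) = f (X ∪ Y) - f Y`, by two calls of the oracle for `f`. -/
noncomputable def gain {κ : Type} [DecidableEq κ] (X Y : Finset κ) :
    OracleProg (Finset κ) ℝ := do
  let a ← OracleProg.ask (X ∪ Y)
  let b ← OracleProg.ask Y
  pure (a - b)

/-! ### The algorithm Storm

Items are named by the elements of a linearly ordered type `ι`, the order being the order of
arrival. The algorithms see an item only through its name and the value oracle. -/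

/-- How ties in the `argmin` and `argmax` of the algorithms are broken. The choice may depend on the
time step, on the copy `g` of Storm and on the index `j` of the candidate set. -/
structure TieRule (ι : Type) where
  /-- which item of a candidate set to consider for replacement -/
  item : (time : ι) → (g j : ℕ) → Finset ι → ι
  item_mem : ∀ i g j s, s.Nonempty → item i g j s ∈ s
  /-- which active candidate set to output -/
  cand : (time : ι) → (g : ℕ) → Finset ℕ → ℕ
  cand_mem : ∀ i g s, s.Nonempty → cand i g s ∈ s
  /-- which of the guesses to follow -/
  guess : (time : ι) → Finset ℕ → ℕ
  guess_mem : ∀ i s, s.Nonempty → guess i s ∈ s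

/-- The memory of Storm run with parameter `g`: candidate sets `cand 1, …, cand g` and the indices
of the active ones. The inactive candidate sets are the ones that have been output. -/
structure StormState (ι : Type) where
  cand : ℕ → Finset ι
  active : Finset ℕ

namespace StormState

variable {ι : Type} [LinearOrder ι]

/-- All candidate sets are empty and active. -/
def init (ι : Type) (g : ℕ) : StormState ι where
  cand := fun _ => ∅
  active := Finset.Icc 1 g

/-- The union of all `g` candidate sets, as a set of copies. -/
def pool (g : ℕ) (s : StormState ι) : Finset (ι × ℕ) := copies (Finset.Icc 1 g) s.cand

/-- The union of the sets output so far, as a set of copies. -/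
def shown (g : ℕ) (s : StormState ι) : Finset (ι × ℕ) :=
  copies (Finset.Icc 1 g \ s.active) s.cand

/-- The copies in the pool that were added before the copy `x`. The copies of one item are added in
increasing order of the index of the candidate set. -/
def poolBefore (g : ℕ) (s : StormState ι) (x : ι × ℕ) : Finset (ι × ℕ) :=
  (s.pool g).filter fun y => y.1 < x.1 ∨ (y.1 = x.1 ∧ y.2 < x.2)

/-- The value `ν (f, pool, x)`: the gain of `x` over the part of the pool that was added before. -/
noncomputable def nu (g : ℕ) (s : StormState ι) (x : ι × ℕ) :
    OracleProg (Finset (ι × ℕ)) ℝ :=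
  gain {x} (s.poolBefore g x)

/-- Offers the arriving item `i` to the candidate set `j`: it is added if there is room, and
otherwise replaces the item `v` of least `ν` if its gain over the pool is at least `2 ν(v)`. -/
noncomputable def offer (tie : TieRule ι) (k g : ℕ) (i : ι) (s : StormState ι) (j : ℕ) :
    OracleProg (Finset (ι × ℕ)) (StormState ι) :=
  if (s.cand j).card < k then
    pure { s with cand := Function.update s.cand j (insert i (s.cand j)) }
  else do
    let v ← OracleProg.argmin (tie.item i g j) ((s.cand j).sort (· ≤ ·)) fun w => s.nu g (w, j)
    let a ← gain {(i, j)} (s.pool g)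
    let b ← s.nu g (v, j)
    if 2 * b ≤ a then
      pure { s with cand := Function.update s.cand j (insert i ((s.cand j).erase v)) }
    else
      pure s

/-- Processes the arriving item `i`: it is offered to the active candidate sets one by one. -/
noncomputable def process (tie : TieRule ι) (k g : ℕ) (i : ι) (s : StormState ι) :
    OracleProg (Finset (ι × ℕ)) (StormState ι) :=
  (s.active.sort (· ≤ ·)).foldlM (offer tie k g i) s

/-- Answers a request at time `i`: outputs and deactivates an active candidate set of largest gain
over the sets output before. If no candidate set is active any more, the output is empty. -/
noncomputable def respond (tie : TieRule ι) (g : ℕ) (i : ι) (s : StormState ι) :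
    OracleProg (Finset (ι × ℕ)) (StormState ι × Finset ι) :=
  if s.active = ∅ then
    pure (s, ∅)
  else do
    let j ← OracleProg.argmax (tie.cand i g) (s.active.sort (· ≤ ·))
      fun q => gain (copies {q} s.cand) (s.shown g)
    pure ({ s with active := s.active.erase j }, s.cand j)

/-- Words of memory: a name and a probability for each stored item, an activity flag for each
candidate set, and a counter. -/
def words (g : ℕ) (s : StormState ι) : ℕ :=
  2 * (∑ q ∈ Finset.Icc 1 g, (s.cand q).card) + g + 1

end StormState

/-! ### The algorithm Storm++ -/

/-- The guesses `δ, 2δ, …, ⌈T' / δ⌉ δ`. -/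
noncomputable def guesses (T' δ : ℕ) : Finset ℕ :=
  (Finset.Icc 1 ⌈(T' : ℝ) / (δ : ℝ)⌉₊).image fun m => m * δ

/-- The memory of Storm++: `copy g` is the state of the copy of Storm with parameter `g` (only
guesses `g` matter), `visits` counts the requests so far, and `out 1, …, out visits` are the sets
presented so far. -/
structure PPState (ι : Type) where
  copy : ℕ → StormState ι
  visits : ℕ
  out : ℕ → Finset ι

namespace PPState

variable {ι : Type} [LinearOrder ι]

def init (ι : Type) : PPState ι where
  copy := fun g => StormState.init ι g
  visits := 0
  out := fun _ => ∅

/-- Words of memory: those of all copies of Storm, a name and a probability for each presented item,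
and a counter. -/
def words (G : Finset ℕ) (σ : PPState ι) : ℕ :=
  (∑ g ∈ G, (σ.copy g).words g) + 2 * (∑ t ∈ Finset.Icc 1 σ.visits, (σ.out t).card) + 1

/-- The greedy choice at a request: a guess whose proposed set has the largest gain over the sets
presented so far. -/
noncomputable def aggregate (tie : TieRule ι) (G : Finset ℕ) (i : ι) (σ : PPState ι)
    (proposal : ℕ → Finset ι) : OracleProg (Finset (ι × ℕ)) ℕ :=
  OracleProg.argmax (tie.guess i) (G.sort (· ≤ ·)) fun g =>
    gain (proposal g ×ˢ {σ.visits + 1}) (copies (Finset.Icc 1 σ.visits) σ.out)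

end PPState

/-- What happens at one time step: the new state, the number of all oracle calls, and the response
time, that is, the number of oracle calls made one after the other between request and answer (`0`
if there is no request). -/
structure StepResult (ι : Type) where
  state : PPState ι
  calls : ℕ
  response : ℕ

/-- One time step of Storm++: the item `i` arrives, and `access` tells whether there is a request.
Each copy of Storm processes the item. At a request each copy of Storm makes a proposal, and the
greedy choice among the proposals is presented. All oracle calls are added up in `calls`; for the
response time the copies of Storm run in parallel, so that the slowest copy counts, and the calls of
the greedy choice come after it. -/
noncomputable def stormPPStep {ι : Type} [LinearOrder ι] (f : Finset (ι × ℕ) → ℝ)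
    (tie : TieRule ι) (k : ℕ) (G : Finset ℕ) (σ : PPState ι) (i : ι) (access : Bool) :
    StepResult ι :=
  let arrived : ℕ → StormState ι × ℕ := fun g => ((σ.copy g).process tie k g i).run f
  if access = true then
    let proposed : ℕ → (StormState ι × Finset ι) × ℕ :=
      fun g => ((arrived g).1.respond tie g i).run f
    let chosen : ℕ × ℕ := (σ.aggregate tie G i fun g => (proposed g).1.2).run f
    { state :=
        { copy := fun g => (proposed g).1.1
          visits := σ.visits + 1
          out := Function.update σ.out (σ.visits + 1) (proposed chosen.1).1.2 }
      calls := (∑ g ∈ G, (arrived g).2) + (∑ g ∈ G, (proposed g).2) + chosen.2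
      response := (G.sup fun g => (proposed g).2) + chosen.2 }
  else
    { state := { σ with copy := fun g => (arrived g).1 }
      calls := ∑ g ∈ G, (arrived g).2
      response := 0 }

namespace StormPP

variable {d N : ℕ}

/-- The state of Storm++ after the first `n` time steps. -/
noncomputable def stateAfter (S : NewsStream d N) (tie : TieRule (Fin N)) (k T' δ : ℕ) :
    ℕ → PPState (Fin N)
  | 0 => PPState.init (Fin N)
  | n + 1 =>
    if h : n < N then
      (stormPPStep S.coverage tie k (guesses T' δ) (stateAfter S tie k T' δ n) ⟨n, h⟩
        (S.access ⟨n, h⟩)).state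
    else stateAfter S tie k T' δ n

/-- The time step `i` of Storm++. -/
noncomputable def stepAt (S : NewsStream d N) (tie : TieRule (Fin N)) (k T' δ : ℕ) (i : Fin N) :
    StepResult (Fin N) :=
  stormPPStep S.coverage tie k (guesses T' δ) (stateAfter S tie k T' δ i) i (S.access i)

/-- The set presented at the `t`-th access. -/
noncomputable def output (S : NewsStream d N) (tie : TieRule (Fin N)) (k T' δ : ℕ) (t : ℕ) :
    Finset (Fin N) :=
  (stateAfter S tie k T' δ N).out t

/-- Time: the number of oracle calls over the entire stream. -/
noncomputable def time (S : NewsStream d N) (tie : TieRule (Fin N)) (k T' δ : ℕ) : ℕ :=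
  ∑ i, (stepAt S tie k T' δ i).calls

/-- Response time: the largest response time over all requests. -/
noncomputable def responseTime (S : NewsStream d N) (tie : TieRule (Fin N)) (k T' δ : ℕ) : ℕ :=
  Finset.univ.sup fun i => (stepAt S tie k T' δ i).response

/-- Space: the largest number of words in use at any time. During a time step these are the words of
the state (which does not shrink during the step), two words for the arriving item, and one word
for each oracle answer received in that step. -/
noncomputable def space (S : NewsStream d N) (tie : TieRule (Fin N)) (k T' δ : ℕ) : ℕ :=
  max ((PPState.init (Fin N)).words (guesses T' δ))
    (Finset.univ.sup fun i =>
      (stepAt S tie k T' δ i).state.words (guesses T' δ) + 2 + (stepAt S tie k T' δ i).calls)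

end StormPP

end S3MOR

/-! The factor `8 * δ` is a product of three losses. Let `T` be the number of accesses. Rounding `T`
up to a multiple of `δ` gives a guess `g` with `T ≤ g < T + δ` (`exists_guess`); Storm++ is compared
with the offline solution through this one copy of Storm.

Factor 4, solution against pool. Let `E` consist of all copies ever accepted. Accepting a copy of
gain `a` in place of one of value `ν ≤ a / 2` raises `f E` by at most `a` and `f pool` by at least
`a - ν ≥ a / 2`, so `f E ≤ 2 f pool`. A rejected copy gains over `E` at most twice the `ν` of each
item in the full set that rejected it, and this persists because the smallest `ν` in a full set
never drops (`Accounted.offer`). Match the `t`-th set of the solution with the candidate set output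
at access `t`, which was still active then and so was offered all items available. As the `ν` add up
to `f pool`, the solution is worth at most `f E + 2 f pool ≤ 4 f pool`
(`Accounted.le_four_mul_pool`).

Factor `δ`, pool against output. Just before the last answer at most `δ` sets are active, and the
best of them is output (`pool_le_shown`).

Factor 2, one copy against Storm++. Each presented set gains over the earlier ones at least as much
as the proposal of copy `g`, so the presented sets together with all outputs of that copy are worth
at most twice the presented sets alone (`greedy_step`).

Feasibility and complexity come from size invariants (`Sound`) and call counts (`complexity_le`):
there are at most `2 * T' / δ` guesses, each at most `2 * T'`. -/

namespace S3MOR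

/-! ### Results and call counts of oracle programs -/

namespace OracleProg

variable {Q α β : Type}

@[simp] theorem run_pure (f : Q → ℝ) (a : α) : run f (pure a : OracleProg Q α) = (a, 0) := rfl

theorem run_bind' (f : Q → ℝ) (p : OracleProg Q α) (h : α → OracleProg Q β) :
    run f (p.bind h) = ((run f (h (run f p).1)).1, (run f p).2 + (run f (h (run f p).1)).2) := by
  induction p with
  | done a => simp [OracleProg.bind, run]
  | query q next ih =>
    simp only [OracleProg.bind, run, ih]
    ext
    · rfl
    · simp only; omega

@[simp] theorem run_bind (f : Q → ℝ) (p : OracleProg Q α) (h : α → OracleProg Q β) :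
    run f (p >>= h) = ((run f (h (run f p).1)).1, (run f p).2 + (run f (h (run f p).1)).2) :=
  run_bind' f p h

@[simp] theorem run_ask (f : Q → ℝ) (q : Q) : run f (ask q) = (f q, 1) := rfl

theorem run_evalAll (f : Q → ℝ) (val : β → OracleProg Q ℝ) (cs : List β) :
    run f (evalAll val cs) =
      (cs.map fun c => (c, (run f (val c)).1), (cs.map fun c => (run f (val c)).2).sum) := by
  induction cs with
  | nil => rfl
  | cons c cs ih => simp [evalAll, ih]

theorem argmax_spec [DecidableEq β] (f : Q → ℝ) {pick : Finset β → β}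
    (hpick : ∀ s, s.Nonempty → pick s ∈ s) {cs : List β} (hcs : cs ≠ [])
    (val : β → OracleProg Q ℝ) :
    (run f (argmax pick cs val)).1 ∈ cs ∧
      ∀ c ∈ cs, (run f (val c)).1 ≤ (run f (val (run f (argmax pick cs val)).1)).1 := by
  classical
  have hne : cs.toFinset.Nonempty := by simpa using hcs
  obtain ⟨m, hm, hmax⟩ := cs.toFinset.exists_max_image (fun c => (run f (val c)).1) hne
  have key := hpick ((((cs.map fun c => (c, (run f (val c)).1)).filter
    fun x => ∀ y ∈ (cs.map fun c => (c, (run f (val c)).1)), y.2 ≤ x.2).map Prod.fst).toFinset)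
    ⟨m, by simp at hm hmax ⊢; exact ⟨hm, hmax⟩⟩
  simp only [argmax, run_bind, run_evalAll, run_pure]
  obtain ⟨x, hx, h3⟩ := List.mem_map.1 (List.mem_toFinset.1 key)
  obtain ⟨hx1, h2⟩ := List.mem_filter.1 hx
  obtain ⟨c, hc, rfl⟩ := List.mem_map.1 hx1
  rw [← h3]
  rw [decide_eq_true_eq] at h2
  exact ⟨hc, fun b hb => h2 (b, _) (List.mem_map.2 ⟨b, hb, rfl⟩)⟩

theorem argmax_calls [DecidableEq β] (f : Q → ℝ) (pick : Finset β → β) (cs : List β)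
    (val : β → OracleProg Q ℝ) :
    (run f (argmax pick cs val)).2 = (cs.map fun c => (run f (val c)).2).sum := by
  simp [argmax, run_evalAll]

theorem argmin_spec [DecidableEq β] (f : Q → ℝ) {pick : Finset β → β}
    (hpick : ∀ s, s.Nonempty → pick s ∈ s) {cs : List β} (hcs : cs ≠ [])
    (val : β → OracleProg Q ℝ) :
    (run f (argmin pick cs val)).1 ∈ cs ∧
      ∀ c ∈ cs, (run f (val (run f (argmin pick cs val)).1)).1 ≤ (run f (val c)).1 := by
  classical
  have hne : cs.toFinset.Nonempty := by simpa using hcs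
  obtain ⟨m, hm, hmin⟩ := cs.toFinset.exists_min_image (fun c => (run f (val c)).1) hne
  have key := hpick ((((cs.map fun c => (c, (run f (val c)).1)).filter
    fun x => ∀ y ∈ (cs.map fun c => (c, (run f (val c)).1)), x.2 ≤ y.2).map Prod.fst).toFinset)
    ⟨m, by simp at hm hmin ⊢; exact ⟨hm, hmin⟩⟩
  simp only [argmin, run_bind, run_evalAll, run_pure]
  obtain ⟨x, hx, h3⟩ := List.mem_map.1 (List.mem_toFinset.1 key)
  obtain ⟨hx1, h2⟩ := List.mem_filter.1 hx
  obtain ⟨c, hc, rfl⟩ := List.mem_map.1 hx1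
  rw [← h3]
  rw [decide_eq_true_eq] at h2
  exact ⟨hc, fun b hb => h2 (b, _) (List.mem_map.2 ⟨b, hb, rfl⟩)⟩

theorem argmin_calls [DecidableEq β] (f : Q → ℝ) (pick : Finset β → β) (cs : List β)
    (val : β → OracleProg Q ℝ) :
    (run f (argmin pick cs val)).2 = (cs.map fun c => (run f (val c)).2).sum := by
  simp [argmin, run_evalAll]

theorem run_foldlM_cons (f : Q → ℝ) (step : α → β → OracleProg Q α) (a : α) (b : β)
    (l : List β) :
    run f ((b :: l).foldlM step a) =
      ((run f (l.foldlM step (run f (step a b)).1)).1,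
        (run f (step a b)).2 + (run f (l.foldlM step (run f (step a b)).1)).2) := by
  rw [List.foldlM_cons, run_bind]

/-- An invariant of the single steps is an invariant of a monadic fold, and a bound on the calls of
the single steps bounds the calls of the fold. -/
theorem run_foldlM_invariant (f : Q → ℝ) (step : α → β → OracleProg Q α) (P : α → Prop) (c : ℕ)
    (l : List β) (hP : ∀ a, P a → ∀ b ∈ l, P (run f (step a b)).1)
    (hc : ∀ a, P a → ∀ b, (run f (step a b)).2 ≤ c) (a : α) (ha : P a) :
    P (run f (l.foldlM step a)).1 ∧ (run f (l.foldlM step a)).2 ≤ l.length * c := by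
  induction l generalizing a with
  | nil => exact ⟨ha, Nat.zero_le _⟩
  | cons b l ih =>
    rw [run_foldlM_cons]
    have h1 := hP a ha b (by simp)
    obtain ⟨h2, h3⟩ := ih (fun a ha b hb => hP a ha b (by simp [hb])) _ h1
    refine ⟨h2, ?_⟩
    have := hc a ha b
    simp only [List.length_cons, Nat.succ_mul]
    omega

end OracleProg

/-! ### Monotone submodular functions -/

/-- The incremental gain of `X` over `Y` with respect to `f`. -/
def marginal {κ : Type} [DecidableEq κ] (f : Finset κ → ℝ) (X Y : Finset κ) : ℝ :=
  f (X ∪ Y) - f Y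

@[simp] theorem run_gain {κ : Type} [DecidableEq κ] (f : Finset κ → ℝ) (X Y : Finset κ) :
    (gain X Y).run f = (marginal f X Y, 2) := by
  simp [gain, marginal]

/-- Normalized monotone submodular set functions. -/
structure IsMonotoneSubmodular {κ : Type} [DecidableEq κ] (f : Finset κ → ℝ) : Prop where
  map_empty : f ∅ = 0
  mono : Monotone f
  marginal_anti : ∀ (X : Finset κ) {Y Z : Finset κ}, Y ⊆ Z → marginal f X Z ≤ marginal f X Y

namespace IsMonotoneSubmodular

variable {κ : Type} [DecidableEq κ] {f : Finset κ → ℝ}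

theorem nonneg (hf : IsMonotoneSubmodular f) (X : Finset κ) : 0 ≤ f X := by
  rw [← hf.map_empty]; exact hf.mono (Finset.empty_subset X)

theorem marginal_nonneg (hf : IsMonotoneSubmodular f) (X Y : Finset κ) : 0 ≤ marginal f X Y :=
  sub_nonneg.2 (hf.mono Finset.subset_union_right)

theorem marginal_eq_zero {X Y : Finset κ} (h : X ⊆ Y) : marginal f X Y = 0 := by
  simp [marginal, Finset.union_eq_right.2 h]

/-- Adding the sets one at a time, each gains at most what it would gain over `Y` alone, by
submodularity. -/
theorem map_union_biUnion_le (hf : IsMonotoneSubmodular f) {ι : Type} (I : Finset ι)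
    (B : ι → Finset κ) (Y : Finset κ) :
    f (I.biUnion B ∪ Y) ≤ f Y + ∑ j ∈ I, marginal f (B j) Y := by
  classical
  induction I using Finset.induction_on with
  | empty => simp
  | insert j I hj ih =>
    rw [Finset.sum_insert hj, Finset.biUnion_insert, Finset.union_assoc]
    have := hf.marginal_anti (B j) (Finset.subset_union_right : Y ⊆ I.biUnion B ∪ Y)
    have h2 : f (B j ∪ (I.biUnion B ∪ Y)) - f (I.biUnion B ∪ Y) ≤ marginal f (B j) Y := this
    linarith

end IsMonotoneSubmodular

/-! ### Coverage as a monotone submodular function -/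

namespace NewsStream

variable {d N : ℕ}

/-- The probability that topic `c` is not covered by a presentation of the copies in `X`. -/
noncomputable def miss (S : NewsStream d N) (c : Fin d) (X : Finset (Fin N × ℕ)) : ℝ :=
  ∏ x ∈ X with c ∈ S.topics x.1, (1 - S.prob x.1)

theorem coverage_eq (S : NewsStream d N) (X : Finset (Fin N × ℕ)) :
    S.coverage X = ∑ c, (1 - S.miss c X) := rfl

theorem miss_nonneg (S : NewsStream d N) (c : Fin d) (X : Finset (Fin N × ℕ)) :
    0 ≤ S.miss c X :=
  Finset.prod_nonneg fun x _ => sub_nonneg.2 (S.prob_mem x.1).2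

theorem miss_le_one (S : NewsStream d N) (c : Fin d) (X : Finset (Fin N × ℕ)) :
    S.miss c X ≤ 1 :=
  Finset.prod_le_one (fun x _ => sub_nonneg.2 (S.prob_mem x.1).2)
    fun x _ => by linarith [(S.prob_mem x.1).1]

theorem miss_union (S : NewsStream d N) (c : Fin d) {X Y : Finset (Fin N × ℕ)}
    (h : Disjoint X Y) : S.miss c (X ∪ Y) = S.miss c X * S.miss c Y := by
  rw [miss, Finset.filter_union, Finset.prod_union (Finset.disjoint_filter_filter h)]
  rfl

theorem miss_anti (S : NewsStream d N) (c : Fin d) {X Y : Finset (Fin N × ℕ)} (h : X ⊆ Y) :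
    S.miss c Y ≤ S.miss c X := by
  rw [← Finset.sdiff_union_of_subset h, S.miss_union c Finset.sdiff_disjoint]
  exact mul_le_of_le_one_left (S.miss_nonneg c X) (S.miss_le_one c _)

theorem miss_image (S : NewsStream d N) (c : Fin d) {X : Finset (Fin N × ℕ)}
    {φ : Fin N × ℕ → Fin N × ℕ} (hφ : Set.InjOn φ X) (h1 : ∀ x ∈ X, (φ x).1 = x.1) :
    S.miss c (X.image φ) = S.miss c X := by
  rw [miss, miss, Finset.prod_filter, Finset.prod_filter, Finset.prod_image hφ]
  exact Finset.prod_congr rfl fun x hx => by rw [h1 x hx]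

/-- Only the items of the copies matter, not their tags. This allows the `t`-th set of a solution to
be retagged by a candidate set. -/
theorem coverage_image (S : NewsStream d N) {X : Finset (Fin N × ℕ)}
    {φ : Fin N × ℕ → Fin N × ℕ} (hφ : Set.InjOn φ X) (h1 : ∀ x ∈ X, (φ x).1 = x.1) :
    S.coverage (X.image φ) = S.coverage X := by
  simp only [coverage_eq, S.miss_image _ hφ h1]

/-- A topic is gained when `Y` misses it and the new copies cover it. Both factors are nonnegative
and decrease as `Y` grows, which yields submodularity. -/
theorem marginal_coverage (S : NewsStream d N) (X Y : Finset (Fin N × ℕ)) :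
    marginal S.coverage X Y = ∑ c, S.miss c Y * (1 - S.miss c (X \ Y)) := by
  rw [marginal, coverage_eq, coverage_eq, ← Finset.sum_sub_distrib]
  refine Finset.sum_congr rfl fun c _ => ?_
  rw [← Finset.sdiff_union_self_eq_union, S.miss_union c Finset.sdiff_disjoint]
  ring

theorem coverage_isMonotoneSubmodular (S : NewsStream d N) :
    IsMonotoneSubmodular S.coverage where
  map_empty := by simp [coverage]
  mono := fun X Y h => Finset.sum_le_sum fun c _ => sub_le_sub_left (S.miss_anti c h) 1
  marginal_anti := fun X Y Z h => by
    rw [marginal_coverage, marginal_coverage]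
    refine Finset.sum_le_sum fun c _ => mul_le_mul (S.miss_anti c h) ?_ ?_ (S.miss_nonneg c Y)
    · exact sub_le_sub_left (S.miss_anti c (Finset.sdiff_subset_sdiff le_rfl h)) 1
    · exact sub_nonneg.2 (S.miss_le_one c _)

end NewsStream

/-! ### Sets of copies and telescoping sums of gains -/

theorem mem_copies {ι : Type} [DecidableEq ι] {I : Finset ℕ} {A : ℕ → Finset ι} {x : ι × ℕ} :
    x ∈ copies I A ↔ x.2 ∈ I ∧ x.1 ∈ A x.2 := by
  obtain ⟨v, q⟩ := x
  simp only [copies, Finset.mem_biUnion, Finset.mem_product, Finset.mem_singleton]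
  constructor
  · rintro ⟨_, h1, h2, rfl⟩
    exact ⟨h1, h2⟩
  · rintro ⟨h1, h2⟩
    exact ⟨q, h1, h2, rfl⟩

theorem sum_copies {ι : Type} [DecidableEq ι] (I : Finset ℕ) (A : ℕ → Finset ι)
    (w : ι × ℕ → ℝ) : ∑ x ∈ copies I A, w x = ∑ q ∈ I, ∑ v ∈ A q, w (v, q) := by
  rw [copies, Finset.sum_biUnion]
  · exact Finset.sum_congr rfl fun q _ => by rw [Finset.sum_product]; simp
  · intro p _ q _ hpq
    exact Finset.disjoint_left.2 fun x hx hy => hpq <| by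
      simp only [Finset.mem_product, Finset.mem_singleton] at hx hy
      rw [← hx.2, hy.2]

/-- The marginal gains of the elements of a set, taken in lexicographic order, add up to the value
of the set. -/
theorem sum_marginal_before {ι : Type} [LinearOrder ι] {f : Finset (ι × ℕ) → ℝ} (h0 : f ∅ = 0)
    (X : Finset (ι × ℕ)) :
    ∑ x ∈ X, marginal f {x} (X.filter fun y => y.1 < x.1 ∨ (y.1 = x.1 ∧ y.2 < x.2)) = f X := by
  induction X using Finset.induction_on_max_value (toLex : ι × ℕ → ι ×ₗ ℕ) with
  | empty => simp [h0]
  | insert a s ha hle ih =>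
    have hlex : ∀ x y : ι × ℕ, (y.1 < x.1 ∨ (y.1 = x.1 ∧ y.2 < x.2)) ↔ toLex y < toLex x :=
      fun x y => by rw [Prod.Lex.toLex_lt_toLex]
    simp only [hlex] at ih ⊢
    rw [Finset.sum_insert ha]
    -- The largest copy `a` comes after all of `s`, so its gain is taken over `s`, and it precedes
    -- no copy of `s`.
    have h1 : (insert a s).filter (fun y => toLex y < toLex a) = s := by
      ext y
      simp only [Finset.mem_filter, Finset.mem_insert]
      constructor
      · rintro ⟨rfl | h, h'⟩
        · exact absurd h' (lt_irrefl _)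
        · exact h
      · intro h
        refine ⟨Or.inr h, lt_of_le_of_ne (hle y h) fun e => ha ?_⟩
        rw [← toLex.injective e]
        exact h
    have h2 : ∀ x ∈ s, (insert a s).filter (fun y => toLex y < toLex x)
        = s.filter (fun y => toLex y < toLex x) := fun x hx => by
      rw [Finset.filter_insert, if_neg (not_lt.2 (hle x hx))]
    rw [h1, Finset.sum_congr rfl fun x hx => by rw [h2 x hx], ih, marginal,
      ← Finset.insert_eq]
    ring

/-! ### Storm: the values ν and a single offer -/

namespace StormState

variable {ι : Type} [LinearOrder ι] {f : Finset (ι × ℕ) → ℝ}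

/-- The value computed by `nu`. -/
def nuVal (f : Finset (ι × ℕ) → ℝ) (g : ℕ) (s : StormState ι) (x : ι × ℕ) : ℝ :=
  marginal f {x} (s.poolBefore g x)

@[simp] theorem run_nu (f : Finset (ι × ℕ) → ℝ) (g : ℕ) (s : StormState ι) (x : ι × ℕ) :
    (s.nu g x).run f = (s.nuVal f g x, 2) := by
  simp [nu, nuVal]

theorem nuVal_nonneg (hf : IsMonotoneSubmodular f) (g : ℕ) (s : StormState ι) (x : ι × ℕ) :
    0 ≤ s.nuVal f g x := hf.marginal_nonneg _ _

theorem sum_nuVal (hf : IsMonotoneSubmodular f) (g : ℕ) (s : StormState ι) :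
    ∑ q ∈ Finset.Icc 1 g, ∑ v ∈ s.cand q, s.nuVal f g (v, q) = f (s.pool g) := by
  rw [← sum_copies (Finset.Icc 1 g) s.cand (s.nuVal f g)]
  exact sum_marginal_before hf.map_empty (s.pool g)

theorem mem_pool {g : ℕ} {s : StormState ι} {x : ι × ℕ} :
    x ∈ s.pool g ↔ x.2 ∈ Finset.Icc 1 g ∧ x.1 ∈ s.cand x.2 := mem_copies

theorem mem_poolBefore {g : ℕ} {s : StormState ι} {x y : ι × ℕ} :
    y ∈ s.poolBefore g x ↔ y ∈ s.pool g ∧ (y.1 < x.1 ∨ (y.1 = x.1 ∧ y.2 < x.2)) :=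
  Finset.mem_filter

/-- The new state is either an addition, a replacement of a minimizer of `ν`, or unchanged. With `1
≤ k` a full set is nonempty, so the tie rule does return a minimizer. -/
theorem offer_cases (f : Finset (ι × ℕ) → ℝ) (tie : TieRule ι) {k : ℕ} (hk : 1 ≤ k) (g : ℕ)
    (i : ι) (s : StormState ι) (j : ℕ) :
    ((s.cand j).card < k ∧ ((s.offer tie k g i j).run f).1 =
        { s with cand := Function.update s.cand j (insert i (s.cand j)) }) ∨
    (k ≤ (s.cand j).card ∧ ∃ v ∈ s.cand j,
      (∀ w ∈ s.cand j, s.nuVal f g (v, j) ≤ s.nuVal f g (w, j)) ∧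
      ((2 * s.nuVal f g (v, j) ≤ marginal f {(i, j)} (s.pool g) ∧
        ((s.offer tie k g i j).run f).1 =
          { s with cand := Function.update s.cand j (insert i ((s.cand j).erase v)) }) ∨
       (marginal f {(i, j)} (s.pool g) < 2 * s.nuVal f g (v, j) ∧
        ((s.offer tie k g i j).run f).1 = s))) := by
  by_cases h : (s.cand j).card < k
  · exact Or.inl ⟨h, by simp [offer, h]⟩
  · refine Or.inr ⟨not_lt.1 h, ?_⟩
    have hne : (s.cand j).sort (· ≤ ·) ≠ [] := by
      intro h0
      have := congrArg List.length h0
      rw [Finset.length_sort] at this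
      simp only [List.length_nil] at this
      omega
    obtain ⟨h1, h2⟩ := OracleProg.argmin_spec f (tie.item_mem i g j) hne
      fun w => s.nu g (w, j)
    simp only [Finset.mem_sort, run_nu] at h1 h2
    refine ⟨_, h1, h2, ?_⟩
    simp only [offer, h, if_false, OracleProg.run_bind, run_gain, run_nu]
    split_ifs with h3
    · exact Or.inl ⟨h3, rfl⟩
    · exact Or.inr ⟨not_le.1 h3, rfl⟩

/-- At most `2 * k` calls find the minimizer; the gain of `i` and the repeated `ν` of the minimizer
cost two calls each. -/
theorem offer_calls (f : Finset (ι × ℕ) → ℝ) (tie : TieRule ι) {k : ℕ} (g : ℕ)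
    (i : ι) (s : StormState ι) (j : ℕ) (hs : (s.cand j).card ≤ k) :
    ((s.offer tie k g i j).run f).2 ≤ 2 * k + 4 := by
  by_cases h : (s.cand j).card < k
  · simp [offer, h]
  · simp only [offer, h, if_false, OracleProg.run_bind, run_gain, run_nu,
      OracleProg.argmin_calls, List.map_const', List.sum_replicate, Finset.length_sort]
    split_ifs <;> simp only [OracleProg.run_pure, smul_eq_mul] <;> omega

/-- The candidate sets hold at most `k` items, all of which satisfy `p`. -/
def Bounded (k : ℕ) (p : ι → Prop) (s : StormState ι) : Prop :=
  ∀ q, (s.cand q).card ≤ k ∧ ∀ v ∈ s.cand q, p v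

theorem offer_bounded (f : Finset (ι × ℕ) → ℝ) (tie : TieRule ι) {k : ℕ} (hk : 1 ≤ k) (g : ℕ)
    {i : ι} {p : ι → Prop} (hi : p i) {s : StormState ι} (hs : s.Bounded k p) (j : ℕ) :
    ((s.offer tie k g i j).run f).1.Bounded k p := by
  obtain ⟨h, e⟩ | ⟨h, v, hv, -, ⟨-, e⟩ | ⟨-, e⟩⟩ := offer_cases f tie hk g i s j <;> rw [e]
  · intro q
    by_cases hq : q = j
    · subst hq
      simp only [Function.update_self, Finset.mem_insert]
      refine ⟨(Finset.card_insert_le _ _).trans h, ?_⟩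
      rintro w (rfl | hw)
      exacts [hi, (hs q).2 w hw]
    · simpa only [Function.update_of_ne hq] using hs q
  · intro q
    by_cases hq : q = j
    · subst hq
      simp only [Function.update_self, Finset.mem_insert]
      refine ⟨(Finset.card_insert_le _ _).trans ?_, ?_⟩
      · rw [Finset.card_erase_add_one hv]
        exact (hs q).1
      · rintro w (rfl | hw)
        exacts [hi, (hs q).2 w (Finset.mem_of_mem_erase hw)]
    · simpa only [Function.update_of_ne hq] using hs q
  · exact hs

theorem offer_active (f : Finset (ι × ℕ) → ℝ) (tie : TieRule ι) {k : ℕ} (hk : 1 ≤ k) (g : ℕ)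
    (i : ι) (s : StormState ι) (j : ℕ) :
    ((s.offer tie k g i j).run f).1.active = s.active ∧
      ∀ q, q ≠ j → ((s.offer tie k g i j).run f).1.cand q = s.cand q := by
  obtain ⟨h, e⟩ | ⟨h, v, hv, -, ⟨-, e⟩ | ⟨-, e⟩⟩ := offer_cases f tie hk g i s j <;> rw [e]
  · exact ⟨rfl, fun q hq => Function.update_of_ne hq _ _⟩
  · exact ⟨rfl, fun q hq => Function.update_of_ne hq _ _⟩
  · exact ⟨rfl, fun q hq => rfl⟩

/-! ### Storm: charging rejected copies to the pool -/

/-- For the copies in `D`, which have been offered, a set `E` of copies is accounted for by the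
pool: its value is at most twice that of the pool, and the copies of `D` outside `E` were rejected
by a full candidate set, all of whose items have a large value. -/
def Accounted (f : Finset (ι × ℕ) → ℝ) (k g : ℕ) (s : StormState ι) (D : Set (ι × ℕ)) : Prop :=
  ∃ E : Finset (ι × ℕ), s.pool g ⊆ E ∧ f E ≤ 2 * f (s.pool g) ∧
    ∀ x ∈ D, x ∈ E ∨ (k ≤ (s.cand x.2).card ∧
      ∀ v ∈ s.cand x.2, marginal f {x} E ≤ 2 * s.nuVal f g (v, x.2))

theorem Accounted.mono {k g : ℕ} {s : StormState ι} {D D' : Set (ι × ℕ)}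
    (h : s.Accounted f k g D) (hD : D' ⊆ D) : s.Accounted f k g D' := by
  obtain ⟨E, h1, h2, h3⟩ := h
  exact ⟨E, h1, h2, fun x hx => h3 x (hD hx)⟩

/-- The new copy comes after `x`, so the part of the pool before `x` can only lose elements, and the
gain of `x` over it can only grow. -/
theorem nuVal_le_update (hf : IsMonotoneSubmodular f) {g : ℕ} {i : ι} {s : StormState ι} {j : ℕ}
    {B : Finset ι} (hB : B ⊆ s.cand j) {x : ι × ℕ} (hx : x.1 < i ∨ (x.1 = i ∧ x.2 < j)) :
    s.nuVal f g x ≤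
      nuVal f g { s with cand := Function.update s.cand j (insert i B) } x := by
  refine hf.marginal_anti _ fun y hy => ?_
  obtain ⟨v, q⟩ := y
  simp only [mem_poolBefore, mem_pool] at hy ⊢
  refine ⟨⟨hy.1.1, ?_⟩, hy.2⟩
  by_cases hq : q = j
  · subst hq
    have h1 := hy.1.2
    rw [Function.update_self, Finset.mem_insert] at h1
    obtain rfl | h1 := h1
    · exfalso
      obtain h | ⟨h, h'⟩ := hy.2 <;> obtain h2 | ⟨h2, h3⟩ := hx
      · exact lt_asymm h h2
      · exact absurd h2 h.ne'
      · exact absurd h h2.ne'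
      · exact lt_asymm h' h3
    · exact hB h1
  · simpa only [Function.update_of_ne hq] using hy.1.2

/-- Whatever precedes the new copy in the new pool was already in the old pool. -/
theorem marginal_pool_le_nuVal_update (hf : IsMonotoneSubmodular f) {g : ℕ} {i : ι}
    {s : StormState ι} {j : ℕ} {B : Finset ι} (hB : B ⊆ s.cand j) :
    marginal f {(i, j)} (s.pool g) ≤
      nuVal f g { s with cand := Function.update s.cand j (insert i B) } (i, j) := by
  refine hf.marginal_anti _ fun y hy => ?_
  obtain ⟨v, q⟩ := y
  simp only [mem_poolBefore, mem_pool] at hy ⊢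
  refine ⟨hy.1.1, ?_⟩
  by_cases hq : q = j
  · subst hq
    have h1 := hy.1.2
    rw [Function.update_self, Finset.mem_insert] at h1
    obtain rfl | h1 := h1
    · simp at hy
    · exact hB h1
  · simpa only [Function.update_of_ne hq] using hy.1.2

/-- The witness `E` absorbs each accepted copy and never loses any. It gains at most `a`, the gain
of `(i, j)` over the pool, while a replacement still adds at least `a - ν(v) ≥ a / 2` to the pool.
Old rejections stay justified, since gains over `E` fall and the least `ν` in a full set does not; a
new rejection is justified by the failed test. -/
theorem Accounted.offer (hf : IsMonotoneSubmodular f) (tie : TieRule ι) {k : ℕ} (hk : 1 ≤ k)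
    {g : ℕ} {i : ι} {s : StormState ι} {j : ℕ} (hj : j ∈ Finset.Icc 1 g)
    (hlt : ∀ q, ∀ v ∈ s.cand q, v < i ∨ (v = i ∧ q < j)) {D : Set (ι × ℕ)}
    (h : s.Accounted f k g D) :
    Accounted f k g ((s.offer tie k g i j).run f).1 (insert (i, j) D) := by
  obtain ⟨E, hpE, hE, hD⟩ := h
  have hi : i ∉ s.cand j := fun hi => by
    obtain h | ⟨-, h⟩ := hlt j i hi
    exacts [lt_irrefl _ h, lt_irrefl _ h]
  have hgainE : f ({(i, j)} ∪ E) ≤ f E + marginal f {(i, j)} (s.pool g) := by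
    have := hf.marginal_anti {(i, j)} hpE
    rw [marginal] at this
    linarith
  have hEE : ∀ x, marginal f {x} ({(i, j)} ∪ E) ≤ marginal f {x} E := fun x =>
    hf.marginal_anti {x} Finset.subset_union_right
  obtain ⟨h, e⟩ | ⟨h, v, hv, hmin, ⟨ha, e⟩ | ⟨ha, e⟩⟩ := offer_cases f tie hk g i s j <;> rw [e]
  · have hnu := fun x => nuVal_le_update hf (g := g) (i := i) (s := s) (j := j) (x := x)
      (Finset.Subset.refl (s.cand j))
    have hp : pool g { s with cand := Function.update s.cand j (insert i (s.cand j)) } =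
        {(i, j)} ∪ s.pool g := by
      ext ⟨w, q⟩
      simp only [mem_pool, Finset.mem_union, Finset.mem_singleton, Prod.mk.injEq]
      by_cases hq : q = j
      · subst hq
        simp [Function.update_self, (Finset.mem_Icc.1 hj).1, (Finset.mem_Icc.1 hj).2]
      · simp [hq]
    refine ⟨{(i, j)} ∪ E, ?_, ?_, ?_⟩
    · rw [hp]
      exact Finset.union_subset_union_right hpE
    · have h0 := hf.marginal_nonneg {(i, j)} (s.pool g)
      rw [hp]
      rw [marginal] at hgainE h0
      linarith
    · rintro x (rfl | hx)
      · exact Or.inl (by simp)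
      · obtain h1 | ⟨h1, h2⟩ := hD x hx
        · exact Or.inl (Finset.mem_union_right _ h1)
        · have hxj : x.2 ≠ j := fun hxj => absurd (hxj ▸ h1) (not_le.2 h)
          refine Or.inr ?_
          simp only [Function.update_of_ne hxj]
          refine ⟨h1, fun w hw => ?_⟩
          linarith [hEE x, h2 w hw, hnu (w, x.2) (hlt _ w hw)]
  · have hnu := fun x => nuVal_le_update hf (g := g) (i := i) (s := s) (j := j) (x := x)
      (Finset.erase_subset v (s.cand j))
    have hnu' := marginal_pool_le_nuVal_update hf (g := g) (i := i) (s := s) (j := j)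
      (Finset.erase_subset v (s.cand j))
    have hv0 := s.nuVal_nonneg hf g (v, j)
    have hiv : v ≠ i := fun hvi => hi (hvi ▸ hv)
    have hmem : ∀ w q, (w, q) ∈ pool g
        { s with cand := Function.update s.cand j (insert i ((s.cand j).erase v)) } ↔
          (w, q) = (i, j) ∨ ((w, q) ∈ s.pool g ∧ (w, q) ≠ (v, j)) := by
      intro w q
      simp only [mem_pool, ne_eq, Prod.mk.injEq]
      by_cases hq : q = j
      · subst hq
        simp only [hj, Function.update_self, Finset.mem_insert, Finset.mem_erase]
        tauto
      · simp [hq]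
    set s' : StormState ι :=
      { s with cand := Function.update s.cand j (insert i ((s.cand j).erase v)) } with hs'
    -- The new pool together with `v` contains the old pool and `i`. Dropping `v` costs at most its
    -- old `ν`, because everything that preceded `v` is still in the pool.
    have hpool : f (s.pool g) + marginal f {(i, j)} (s.pool g) - s.nuVal f g (v, j) ≤
        f (s'.pool g) := by
      have h1 : f ({(i, j)} ∪ s.pool g) ≤ f ({(v, j)} ∪ s'.pool g) := by
        refine hf.mono fun y hy => ?_
        obtain ⟨w, q⟩ := y
        rw [Finset.mem_union, Finset.mem_singleton] at hy ⊢
        rw [hmem]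
        tauto
      have h2 : marginal f {(v, j)} (s'.pool g) ≤ s.nuVal f g (v, j) := by
        refine hf.marginal_anti _ fun y hy => ?_
        obtain ⟨w, q⟩ := y
        rw [mem_poolBefore] at hy
        rw [hmem]
        refine Or.inr ⟨hy.1, fun hy' => ?_⟩
        rw [Prod.mk.injEq] at hy'
        simp [hy'.1, hy'.2] at hy
      rw [marginal] at h2 ⊢
      linarith
    refine ⟨{(i, j)} ∪ E, ?_, ?_, ?_⟩
    · intro y hy
      obtain ⟨w, q⟩ := y
      rw [hmem] at hy
      rw [Finset.mem_union, Finset.mem_singleton]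
      exact hy.imp_right fun h => hpE h.1
    · linarith
    · rintro x (rfl | hx)
      · exact Or.inl (by simp)
      · obtain h1 | ⟨h1, h2⟩ := hD x hx
        · exact Or.inl (Finset.mem_union_right _ h1)
        · refine Or.inr ?_
          by_cases hxj : x.2 = j
          · rw [hxj] at h1 h2 ⊢
            have hc : s'.cand j = insert i ((s.cand j).erase v) := Function.update_self _ _ _
            rw [hc, Finset.card_insert_of_notMem fun h => hi (Finset.mem_of_mem_erase h),
              Finset.card_erase_add_one hv]
            refine ⟨h1, fun w hw => ?_⟩
            obtain rfl | hw := Finset.mem_insert.1 hw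
            -- The newcomer inherits the bound of `v`, as its `ν` is at least `a ≥ 2 * ν(v) ≥ ν(v)`.
            · linarith [hEE x, h2 v hv]
            · have hw := Finset.mem_of_mem_erase hw
              linarith [hEE x, h2 w hw, hnu (w, j) (hlt _ w hw)]
          · have hc : s'.cand x.2 = s.cand x.2 := Function.update_of_ne hxj _ _
            rw [hc]
            refine ⟨h1, fun w hw => ?_⟩
            linarith [hEE x, h2 w hw, hnu (w, x.2) (hlt _ w hw)]
  · refine ⟨E, hpE, hE, ?_⟩
    rintro x (rfl | hx)
    · refine Or.inr ⟨h, fun w hw => ?_⟩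
      have := hf.marginal_anti {(i, j)} hpE
      linarith [hmin w hw]
    · exact hD x hx

/-- The offers follow increasing `j`, so every stored copy precedes all offers still to come in the
lexicographic order. This is the hypothesis `hlt`, which each step must restore. -/
theorem Accounted.foldlM_offer (hf : IsMonotoneSubmodular f) (tie : TieRule ι) {k : ℕ}
    (hk : 1 ≤ k) {g : ℕ} {i : ι} (l : List ℕ) (hl : l.Pairwise (· < ·)) {s : StormState ι}
    (hlg : ∀ j ∈ l, j ∈ Finset.Icc 1 g)
    (hlt : ∀ q, ∀ v ∈ s.cand q, v < i ∨ (v = i ∧ ∀ j ∈ l, q < j)) {D : Set (ι × ℕ)}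
    (h : s.Accounted f k g D) :
    Accounted f k g ((l.foldlM (StormState.offer tie k g i) s).run f).1
      (D ∪ {x | x.1 = i ∧ x.2 ∈ l}) := by
  induction l generalizing s D with
  | nil => simpa using h
  | cons j l ih =>
    rw [OracleProg.run_foldlM_cons]
    rw [List.pairwise_cons] at hl
    have h1 := Accounted.offer hf tie hk (hlg j (by simp))
      (fun q v hv => (hlt q v hv).imp_right fun h => ⟨h.1, h.2 j (by simp)⟩) h
    refine (ih hl.2 (fun q hq => hlg q (by simp [hq])) (fun q v hv => ?_) h1).mono ?_
    · by_cases hq : q = j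
      · subst hq
        have hvi : v ∈ s.cand q ∨ v = i := by
          obtain ⟨-, e⟩ | ⟨-, w, -, -, ⟨-, e⟩ | ⟨-, e⟩⟩ := offer_cases f tie hk g i s q <;>
            rw [e] at hv
          · simp only [Function.update_self, Finset.mem_insert] at hv
            exact hv.symm
          · simp only [Function.update_self, Finset.mem_insert] at hv
            exact hv.symm.imp_left Finset.mem_of_mem_erase
          · exact Or.inl hv
        obtain hv | rfl := hvi
        · exact (hlt q v hv).imp_right fun h => ⟨h.1, fun p hp => h.2 p (by simp [hp])⟩
        · exact Or.inr ⟨rfl, hl.1⟩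
      · rw [(offer_active f tie hk g i s j).2 q hq] at hv
        exact (hlt q v hv).imp_right fun h => ⟨h.1, fun p hp => h.2 p (by simp [hp])⟩
    · rintro x (hx | ⟨hx1, hx2⟩)
      · exact Or.inl (Or.inr hx)
      · obtain rfl | hx2 := List.mem_cons.1 hx2
        · exact Or.inl (Or.inl (Prod.ext hx1 rfl))
        · exact Or.inr ⟨hx1, hx2⟩

theorem Accounted.process (hf : IsMonotoneSubmodular f) (tie : TieRule ι) {k : ℕ} (hk : 1 ≤ k)
    {g : ℕ} {i : ι} {s : StormState ι} (hg : s.active ⊆ Finset.Icc 1 g)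
    (hlt : s.Bounded k (· < i)) {D : Set (ι × ℕ)} (h : s.Accounted f k g D) :
    Accounted f k g ((s.process tie k g i).run f).1 (D ∪ {x | x.1 = i ∧ x.2 ∈ s.active}) := by
  have := Accounted.foldlM_offer hf tie hk (i := i) (s.active.sort (· ≤ ·))
    s.active.sortedLT_sort.pairwise (fun j hj => hg ((Finset.mem_sort _).1 hj))
    (fun q v hv => Or.inl ((hlt q).2 v hv)) h
  simp only [Finset.mem_sort] at this
  exact this

theorem process_bounded (f : Finset (ι × ℕ) → ℝ) (tie : TieRule ι) {k : ℕ} (hk : 1 ≤ k) (g : ℕ)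
    {i : ι} {p : ι → Prop} (hi : p i) {s : StormState ι} (hs : s.Bounded k p) :
    ((s.process tie k g i).run f).1.Bounded k p ∧
      ((s.process tie k g i).run f).2 ≤ s.active.card * (2 * k + 4) := by
  have := OracleProg.run_foldlM_invariant f (StormState.offer tie k g i) (Bounded k p) (2 * k + 4)
    (s.active.sort (· ≤ ·)) (fun a ha j _ => offer_bounded f tie hk g hi ha j)
    (fun a ha j => offer_calls f tie g i a j (ha j).1) s hs
  rwa [Finset.length_sort] at this

theorem process_active (f : Finset (ι × ℕ) → ℝ) (tie : TieRule ι) {k : ℕ} (hk : 1 ≤ k) (g : ℕ)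
    (i : ι) (s : StormState ι) :
    ((s.process tie k g i).run f).1.active = s.active ∧
      ∀ q, q ∉ s.active → ((s.process tie k g i).run f).1.cand q = s.cand q := by
  have key : ∀ (l : List ℕ) (s : StormState ι),
      ((l.foldlM (StormState.offer tie k g i) s).run f).1.active = s.active ∧
      ∀ q, q ∉ l → ((l.foldlM (StormState.offer tie k g i) s).run f).1.cand q = s.cand q := by
    intro l
    induction l with
    | nil => exact fun s => ⟨rfl, fun _ _ => rfl⟩
    | cons j l ih =>
      intro s
      rw [OracleProg.run_foldlM_cons]
      obtain ⟨h1, h2⟩ := offer_active f tie hk g i s j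
      obtain ⟨h3, h4⟩ := ih ((s.offer tie k g i j).run f).1
      refine ⟨h3.trans h1, fun q hq => ?_⟩
      rw [List.mem_cons, not_or] at hq
      exact (h4 q hq.2).trans (h2 q hq.1)
  obtain ⟨h1, h2⟩ := key (s.active.sort (· ≤ ·)) s
  exact ⟨h1, fun q hq => h2 q fun h => hq ((Finset.mem_sort _).1 h)⟩

/-- Items are offered to active sets only, so sets already output are frozen. -/
theorem process_shown (f : Finset (ι × ℕ) → ℝ) (tie : TieRule ι) {k : ℕ} (hk : 1 ≤ k) (g : ℕ)
    (i : ι) (s : StormState ι) :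
    ((s.process tie k g i).run f).1.shown g = s.shown g := by
  obtain ⟨h1, h2⟩ := process_active f tie hk g i s
  ext x
  simp only [shown, mem_copies, h1, Finset.mem_sdiff]
  exact and_congr_right fun h => by rw [h2 _ h.2]

/-! ### Storm: outputs compared with the pool and with a solution -/

theorem respond_empty (f : Finset (ι × ℕ) → ℝ) (tie : TieRule ι) (g : ℕ) (i : ι)
    {s : StormState ι} (hs : s.active = ∅) : (s.respond tie g i).run f = ((s, ∅), 0) := by
  simp [respond, hs]

theorem respond_spec (f : Finset (ι × ℕ) → ℝ) (tie : TieRule ι) (g : ℕ) (i : ι)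
    {s : StormState ι} (hs : s.active.Nonempty) :
    ∃ j ∈ s.active,
      (s.respond tie g i).run f =
        (({ s with active := s.active.erase j }, s.cand j), 2 * s.active.card) ∧
      ∀ q ∈ s.active, marginal f (copies {q} s.cand) (s.shown g) ≤
        marginal f (copies {j} s.cand) (s.shown g) := by
  have hne : s.active.sort (· ≤ ·) ≠ [] := by
    intro h0
    have := congrArg List.length h0
    rw [Finset.length_sort] at this
    exact hs.card_pos.ne' this
  obtain ⟨h1, h2⟩ := OracleProg.argmax_spec f (tie.cand_mem i g) hne
    fun q => gain (copies {q} s.cand) (s.shown g)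
  simp only [Finset.mem_sort, run_gain] at h1 h2
  refine ⟨_, h1, ?_, h2⟩
  simp [respond, hs.ne_empty, OracleProg.argmax_calls, mul_comm]

theorem respond_bounded (f : Finset (ι × ℕ) → ℝ) (tie : TieRule ι) {k : ℕ} (g : ℕ) (i : ι)
    {p : ι → Prop} {s : StormState ι} (hs : s.Bounded k p) :
    ((s.respond tie g i).run f).1.1.Bounded k p ∧
    ((s.respond tie g i).run f).1.1.active ⊆ s.active ∧
    ((s.respond tie g i).run f).1.2.card ≤ k ∧
    (∀ v ∈ ((s.respond tie g i).run f).1.2, p v) ∧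
    ((s.respond tie g i).run f).2 ≤ 2 * s.active.card := by
  obtain h | h := s.active.eq_empty_or_nonempty
  · rw [respond_empty f tie g i h]
    exact ⟨hs, le_rfl, by simp, by simp, by simp⟩
  · obtain ⟨j, -, e, -⟩ := respond_spec f tie g i h
    rw [e]
    exact ⟨hs, Finset.erase_subset _ _, (hs j).1, (hs j).2, le_rfl⟩

theorem shown_erase {g : ℕ} {s : StormState ι} {j : ℕ} (hj : j ∈ Finset.Icc 1 g) :
    shown g { s with active := s.active.erase j } = copies {j} s.cand ∪ s.shown g := by
  ext ⟨w, q⟩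
  simp only [shown, mem_copies, Finset.mem_union, Finset.mem_sdiff, Finset.mem_erase,
    Finset.mem_singleton]
  by_cases hq : q = j
  · subst hq
    simp only [hj]
    tauto
  · simp only [hq]
    tauto

/-- If at most `δ` candidate sets are active, then outputting the best one of them loses at most the
factor `δ` against the pool. -/
theorem pool_le_shown (hf : IsMonotoneSubmodular f) {g δ : ℕ} {s : StormState ι} {j : ℕ}
    (hg : s.active ⊆ Finset.Icc 1 g) (hj : j ∈ s.active) (hδ : s.active.card ≤ δ)
    (hmax : ∀ q ∈ s.active, marginal f (copies {q} s.cand) (s.shown g) ≤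
        marginal f (copies {j} s.cand) (s.shown g)) :
    f (s.pool g) ≤ δ * f (shown g { s with active := s.active.erase j }) := by
  have h1 : s.pool g ⊆ s.active.biUnion (fun q => copies {q} s.cand) ∪ s.shown g := by
    rintro ⟨w, q⟩ h
    rw [mem_pool] at h
    simp only [shown, Finset.mem_union, Finset.mem_biUnion, mem_copies, Finset.mem_sdiff,
      Finset.mem_singleton]
    by_cases hq : q ∈ s.active
    · exact Or.inl ⟨q, hq, rfl, h.2⟩
    · exact Or.inr ⟨⟨h.1, hq⟩, h.2⟩
  have h2 := hf.map_union_biUnion_le s.active (fun q => copies {q} s.cand) (s.shown g)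
  have h3 := Finset.sum_le_card_nsmul _ _ _ hmax
  have h4 := hf.mono h1
  have h5 := hf.marginal_nonneg (copies {j} s.cand) (s.shown g)
  have h6 : (s.active.card : ℝ) ≤ δ := by exact_mod_cast hδ
  have h7 : (1 : ℝ) ≤ δ := by
    exact_mod_cast (Finset.card_pos.2 ⟨j, hj⟩).trans_le hδ
  have h8 := mul_le_mul_of_nonneg_right h6 h5
  -- The pool is worth at most `f shown` plus `δ` times the best gain; since `1 ≤ δ`, the term `f
  -- shown` may be multiplied by `δ` as well.
  have h9 := mul_nonneg (sub_nonneg.2 h7) (hf.nonneg (s.shown g))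
  rw [shown_erase (hg hj)]
  rw [nsmul_eq_mul] at h3
  rw [marginal] at h3 h8
  linarith

/-- A solution all of whose copies were offered, at most `k` per candidate set, has at most four
times the value of the pool. -/
theorem Accounted.le_four_mul_pool (hf : IsMonotoneSubmodular f) {k g : ℕ} {s : StormState ι}
    {D : Set (ι × ℕ)} (h : s.Accounted f k g D) {I : Finset ℕ} {O : ℕ → Finset ι} {J : ℕ → ℕ}
    (hJ : Set.InjOn J I) (hJg : ∀ t ∈ I, J t ∈ Finset.Icc 1 g) (hO : ∀ t ∈ I, (O t).card ≤ k)
    (hOD : ∀ t ∈ I, ∀ o ∈ O t, (o, J t) ∈ D) :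
    f ((copies I O).image fun x => (x.1, J x.2)) ≤ 4 * f (s.pool g) := by
  obtain ⟨E, hpE, hE, hD⟩ := h
  have hset : (copies I O).image (fun x => (x.1, J x.2)) ⊆
      I.biUnion (fun t => (O t).biUnion fun o => {(o, J t)}) ∪ E := by
    intro y hy
    obtain ⟨x, hx, rfl⟩ := Finset.mem_image.1 hy
    rw [mem_copies] at hx
    simp only [Finset.mem_union, Finset.mem_biUnion, Finset.mem_singleton]
    exact Or.inl ⟨x.2, hx.1, x.1, hx.2, rfl⟩
  have h1 := hf.map_union_biUnion_le I (fun t => (O t).biUnion fun o => {(o, J t)}) E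
  have h2 : ∀ t ∈ I, marginal f ((O t).biUnion fun o => {(o, J t)}) E ≤
      2 * ∑ v ∈ s.cand (J t), s.nuVal f g (v, J t) := by
    intro t ht
    have h3 := hf.map_union_biUnion_le (O t) (fun o => {(o, J t)}) E
    have h4 : ∑ o ∈ O t, marginal f {(o, J t)} E ≤
        2 * ∑ v ∈ s.cand (J t), s.nuVal f g (v, J t) := by
      -- If all copies lie in `E` they gain nothing. Otherwise a single rejection certifies that the
      -- candidate set is full, hence has at least as many items as `O t`, and each gain can be
      -- charged to an item of its own.
      by_cases hall : ∀ o ∈ O t, (o, J t) ∈ E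
      · rw [Finset.sum_eq_zero fun o ho => IsMonotoneSubmodular.marginal_eq_zero
          (Finset.singleton_subset_iff.2 (hall o ho))]
        have := Finset.sum_nonneg fun v (_ : v ∈ s.cand (J t)) => s.nuVal_nonneg hf g (v, J t)
        linarith
      · push Not at hall
        obtain ⟨o₀, ho₀, ho₀E⟩ := hall
        obtain ⟨hk, -⟩ := (hD _ (hOD t ht o₀ ho₀)).resolve_left ho₀E
        have hcard : (O t).card ≤ (s.cand (J t)).card := (hO t ht).trans hk
        have hne : (s.cand (J t)).Nonempty :=
          Finset.card_pos.1 ((Finset.card_pos.2 ⟨o₀, ho₀⟩).trans_le hcard)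
        obtain ⟨m, hm, hmin⟩ :=
          (s.cand (J t)).exists_min_image (fun v => s.nuVal f g (v, J t)) hne
        have hm0 := s.nuVal_nonneg hf g (m, J t)
        have h5 : ∀ o ∈ O t, marginal f {(o, J t)} E ≤ 2 * s.nuVal f g (m, J t) := by
          intro o ho
          obtain h6 | ⟨-, h6⟩ := hD _ (hOD t ht o ho)
          · rw [IsMonotoneSubmodular.marginal_eq_zero (Finset.singleton_subset_iff.2 h6)]
            linarith
          · exact h6 m hm
        have h6 := Finset.sum_le_card_nsmul _ _ _ h5
        have h7 := Finset.card_nsmul_le_sum _ _ _ hmin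
        have h8 : ((O t).card : ℝ) ≤ (s.cand (J t)).card := by exact_mod_cast hcard
        have h9 := mul_le_mul_of_nonneg_right h8 hm0
        rw [nsmul_eq_mul] at h6 h7
        linarith
    rw [marginal]
    linarith
  have h3 := Finset.sum_le_sum h2
  rw [← Finset.mul_sum] at h3
  -- By injectivity of `J` no candidate set is charged twice, and all `ν` together make up `f pool`.
  have h4 : ∑ t ∈ I, ∑ v ∈ s.cand (J t), s.nuVal f g (v, J t) ≤ f (s.pool g) := by
    rw [← s.sum_nuVal hf g,
      ← Finset.sum_image (f := fun q => ∑ v ∈ s.cand q, s.nuVal f g (v, q)) hJ]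
    refine Finset.sum_le_sum_of_subset_of_nonneg ?_ fun q _ _ =>
      Finset.sum_nonneg fun v _ => s.nuVal_nonneg hf g (v, q)
    intro q hq
    obtain ⟨t, ht, rfl⟩ := Finset.mem_image.1 hq
    exact hJg t ht
  have h5 := hf.mono hset
  linarith

end StormState

/-! ### Appending an output; counting accesses -/

theorem copies_update_succ {ι : Type} [DecidableEq ι] (n : ℕ) (A : ℕ → Finset ι) (X : Finset ι) :
    copies (Finset.Icc 1 (n + 1)) (Function.update A (n + 1) X) =
      X ×ˢ {n + 1} ∪ copies (Finset.Icc 1 n) A := by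
  ext ⟨v, q⟩
  simp only [mem_copies, Finset.mem_union, Finset.mem_product, Finset.mem_singleton,
    Finset.mem_Icc]
  by_cases hq : q = n + 1
  · subst hq
    simp
  · have : q ≤ n + 1 ↔ q ≤ n := by omega
    simp [hq, this]

theorem disjoint_copies_succ {ι : Type} [DecidableEq ι] (n : ℕ) (A : ℕ → Finset ι)
    (X : Finset ι) : Disjoint (X ×ˢ {n + 1}) (copies (Finset.Icc 1 n) A) := by
  refine Finset.disjoint_left.2 fun x hx hy => ?_
  simp only [mem_copies, Finset.mem_product, Finset.mem_singleton, Finset.mem_Icc] at hx hy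
  omega

theorem copies_singleton {ι : Type} [DecidableEq ι] (q : ℕ) (A : ℕ → Finset ι) :
    copies {q} A = A q ×ˢ {q} := by
  simp [copies]

namespace NewsStream

variable {d N : ℕ}

/-- The number of accesses in the first `n` time steps. -/
def visitsBefore (S : NewsStream d N) (n : ℕ) : ℕ :=
  (Finset.univ.filter fun i : Fin N => (i : ℕ) < n ∧ S.access i = true).card

theorem visitsBefore_le (S : NewsStream d N) (n : ℕ) : S.visitsBefore n ≤ S.numVisits :=
  Finset.card_le_card fun i hi => by
    simp only [Finset.mem_filter] at hi ⊢
    exact ⟨hi.1, hi.2.2⟩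

theorem visitsBefore_eq (S : NewsStream d N) : S.visitsBefore N = S.numVisits := by
  simp [visitsBefore, numVisits]

theorem visitsBefore_succ_of_access (S : NewsStream d N) {n : ℕ} (hn : n < N)
    (h : S.access ⟨n, hn⟩ = true) : S.visitsBefore (n + 1) = S.visitsBefore n + 1 := by
  have : (Finset.univ.filter fun i : Fin N => (i : ℕ) < n + 1 ∧ S.access i = true) =
      insert ⟨n, hn⟩ (Finset.univ.filter fun i : Fin N => (i : ℕ) < n ∧ S.access i = true) := by
    ext i
    simp only [Finset.mem_filter, Finset.mem_univ, true_and, Finset.mem_insert]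
    by_cases hi : i = ⟨n, hn⟩
    · subst hi
      simp [h]
    · have : (i : ℕ) ≠ n := fun h => hi (Fin.ext h)
      have : (i : ℕ) < n + 1 ↔ (i : ℕ) < n := by omega
      simp [hi, this]
  rw [visitsBefore, this, Finset.card_insert_of_notMem (by simp)]
  rfl

theorem visitsBefore_succ_of_not_access (S : NewsStream d N) {n : ℕ} (hn : n < N)
    (h : ¬ S.access ⟨n, hn⟩ = true) : S.visitsBefore (n + 1) = S.visitsBefore n := by
  rw [visitsBefore, visitsBefore]
  congr 1
  ext i
  simp only [Finset.mem_filter, Finset.mem_univ, true_and]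
  by_cases hi : i = ⟨n, hn⟩
  · subst hi
    simp [h]
  · have : (i : ℕ) ≠ n := fun h => hi (Fin.ext h)
    have : (i : ℕ) < n + 1 ↔ (i : ℕ) < n := by omega
    simp [this]

theorem visitsBefore_succ_eq (S : NewsStream d N) (r : Fin N) :
    S.visitsBefore (r + 1) =
      (Finset.univ.filter fun i => i ≤ r ∧ S.access i = true).card := by
  rw [visitsBefore]
  congr 1
  ext i
  simp only [Finset.mem_filter, Finset.mem_univ, true_and, Fin.le_def, Nat.lt_succ_iff]

theorem isVisit_of_access (S : NewsStream d N) {n : ℕ} (hn : n < N)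
    (h : S.access ⟨n, hn⟩ = true) : S.IsVisit (S.visitsBefore n + 1) ⟨n, hn⟩ :=
  ⟨h, by rw [← S.visitsBefore_succ_eq ⟨n, hn⟩]; exact S.visitsBefore_succ_of_access hn h⟩

theorem IsVisit.unique {S : NewsStream d N} {t : ℕ} {r r' : Fin N} (h : S.IsVisit t r)
    (h' : S.IsVisit t r') : r = r' := by
  have key : ∀ {a b : Fin N}, S.IsVisit t a → S.IsVisit t b → ¬ a < b := by
    intro a b ha hb hab
    have : (Finset.univ.filter fun i => i ≤ a ∧ S.access i = true) ⊂
        (Finset.univ.filter fun i => i ≤ b ∧ S.access i = true) := by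
      refine Finset.ssubset_iff_of_subset (fun i hi => ?_) |>.2 ⟨b, ?_, ?_⟩
      · simp only [Finset.mem_filter, Finset.mem_univ, true_and] at hi ⊢
        exact ⟨hi.1.trans hab.le, hi.2⟩
      · simp [hb.1]
      · simp [hab]
    have := Finset.card_lt_card this
    rw [ha.2, hb.2] at this
    exact lt_irrefl _ this
  exact le_antisymm (not_lt.1 (key h' h)) (not_lt.1 (key h h'))

/-- The same proposal is tagged by its candidate set inside Storm and by the access number when
Storm++ evaluates it. -/
theorem miss_product (S : NewsStream d N) (c : Fin d) (B : Finset (Fin N)) (p q : ℕ) :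
    S.miss c (B ×ˢ {p}) = S.miss c (B ×ˢ {q}) := by
  have : B ×ˢ {p} = (B ×ˢ {q}).image fun x : Fin N × ℕ => (x.1, p) := by
    ext ⟨v, r⟩
    simp [eq_comm]
  rw [this]
  refine S.miss_image c (fun x hx y hy hxy => ?_) fun x _ => rfl
  simp only [Finset.coe_product, Set.mem_prod, Finset.coe_singleton, Set.mem_singleton_iff] at hx hy
  simp only [Prod.mk.injEq, and_true] at hxy
  exact Prod.ext hxy (hx.2.trans hy.2.symm)

end NewsStream

/-! ### One time step of Storm++ -/

section Step

variable {ι : Type} [LinearOrder ι] (f : Finset (ι × ℕ) → ℝ) (tie : TieRule ι) (k : ℕ)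
  (G : Finset ℕ) (σ : PPState ι) (i : ι)

/-- The state of the copy `g` of Storm after it has processed the item `i`. -/
noncomputable def PPState.arrived (g : ℕ) : StormState ι :=
  (((σ.copy g).process tie k g i).run f).1

/-- The set proposed by the copy `g` of Storm at a request at time `i`. -/
noncomputable def PPState.proposal (g : ℕ) : Finset ι :=
  (((σ.arrived f tie k i g).respond tie g i).run f).1.2

/-- The guess followed at a request at time `i`. -/
noncomputable def PPState.chosen : ℕ :=
  ((σ.aggregate tie G i (σ.proposal f tie k i)).run f).1

theorem stormPPStep_state_true :
    (stormPPStep f tie k G σ i true).state =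
      { copy := fun g => (((σ.arrived f tie k i g).respond tie g i).run f).1.1
        visits := σ.visits + 1
        out := Function.update σ.out (σ.visits + 1)
          (σ.proposal f tie k i (σ.chosen f tie k G i)) } := rfl

theorem stormPPStep_state_false :
    (stormPPStep f tie k G σ i false).state = { σ with copy := σ.arrived f tie k i } := rfl

theorem chosen_spec (hG : G.Nonempty) :
    ∀ g ∈ G,
      marginal f (σ.proposal f tie k i g ×ˢ {σ.visits + 1})
        (copies (Finset.Icc 1 σ.visits) σ.out) ≤
      marginal f (σ.proposal f tie k i (σ.chosen f tie k G i) ×ˢ {σ.visits + 1})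
        (copies (Finset.Icc 1 σ.visits) σ.out) := by
  have hne : G.sort (· ≤ ·) ≠ [] := by
    intro h0
    have := congrArg List.length h0
    rw [Finset.length_sort] at this
    exact hG.card_pos.ne' this
  obtain ⟨-, h2⟩ := OracleProg.argmax_spec f (tie.guess_mem i) hne fun g =>
    gain (σ.proposal f tie k i g ×ˢ {σ.visits + 1}) (copies (Finset.Icc 1 σ.visits) σ.out)
  simp only [Finset.mem_sort, run_gain] at h2
  exact h2

variable {k σ i} {p : ι → Prop}

/-- The number of oracle calls and the response time of a single step. -/
theorem stormPPStep_calls (hk : 1 ≤ k) (hp : p i) (hb : ∀ g, (σ.copy g).Bounded k p)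
    (hact : ∀ g, (σ.copy g).active ⊆ Finset.Icc 1 g) {L : ℕ} (hL : ∀ g ∈ G, g ≤ L)
    (access : Bool) :
    (stormPPStep f tie k G σ i access).calls ≤ G.card * (L * (2 * k + 6) + 2) ∧
      (stormPPStep f tie k G σ i access).response ≤ 2 * L + 2 * G.card := by
  have hcard : ∀ g, (σ.copy g).active.card ≤ g := fun g => by
    simpa using Finset.card_le_card (hact g)
  have h1 : ∑ g ∈ G, (((σ.copy g).process tie k g i).run f).2 ≤ G.card * (L * (2 * k + 4)) := by
    rw [← smul_eq_mul]
    refine Finset.sum_le_card_nsmul _ _ _ fun g hg => ?_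
    exact (StormState.process_bounded f tie hk g hp (hb g)).2.trans
      (Nat.mul_le_mul_right _ ((hcard g).trans (hL g hg)))
  have h2 : ∀ g ∈ G, (((σ.arrived f tie k i g).respond tie g i).run f).2 ≤ 2 * L := by
    intro g hg
    have h3 := (StormState.respond_bounded f tie g i
      (StormState.process_bounded f tie hk g hp (hb g)).1).2.2.2.2
    rw [(StormState.process_active f tie hk g i (σ.copy g)).1] at h3
    exact h3.trans (Nat.mul_le_mul_left _ ((hcard g).trans (hL g hg)))
  have h3 : ((σ.aggregate tie G i (σ.proposal f tie k i)).run f).2 = 2 * G.card := by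
    simp [PPState.aggregate, OracleProg.argmax_calls, mul_comm]
  cases access with
  | true =>
    have h4 : (stormPPStep f tie k G σ i true).calls =
        ∑ g ∈ G, (((σ.copy g).process tie k g i).run f).2 +
        ∑ g ∈ G, (((σ.arrived f tie k i g).respond tie g i).run f).2 +
        ((σ.aggregate tie G i (σ.proposal f tie k i)).run f).2 := rfl
    have h5 : (stormPPStep f tie k G σ i true).response =
        (G.sup fun g => (((σ.arrived f tie k i g).respond tie g i).run f).2) +
        ((σ.aggregate tie G i (σ.proposal f tie k i)).run f).2 := rfl
    rw [h4, h5, h3]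
    refine ⟨?_, Nat.add_le_add_right (Finset.sup_le h2) _⟩
    -- Each guess contributes `L * (2 * k + 4)` calls for the offers, `2 * L` for its proposal and
    -- `2` for the final choice.
    have h6 := Finset.sum_le_card_nsmul _ _ _ h2
    rw [smul_eq_mul] at h6
    nlinarith
  | false =>
    have h4 : (stormPPStep f tie k G σ i false).calls =
        ∑ g ∈ G, (((σ.copy g).process tie k g i).run f).2 := rfl
    have h5 : (stormPPStep f tie k G σ i false).response = 0 := rfl
    rw [h4, h5]
    refine ⟨h1.trans ?_, Nat.zero_le _⟩
    gcongr
    nlinarith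

end Step

/-! ### Feasibility and size of the memory -/

namespace StormPP

variable {d N : ℕ}

/-- The facts about the state of Storm++ after `n` time steps that bound its size and make its
output feasible. -/
structure Sound (S : NewsStream d N) (k n : ℕ) (σ : PPState (Fin N)) : Prop where
  visits : σ.visits = S.visitsBefore n
  bounded : ∀ g, (σ.copy g).Bounded k fun v : Fin N => (v : ℕ) < n
  active : ∀ g, (σ.copy g).active ⊆ Finset.Icc 1 g
  out : ∀ t ∈ Finset.Icc 1 σ.visits,
    (σ.out t).card ≤ k ∧ ∀ i ∈ σ.out t, ∃ r, S.IsVisit t r ∧ i ≤ r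

theorem sound_init (S : NewsStream d N) (k : ℕ) : Sound S k 0 (PPState.init (Fin N)) where
  visits := by simp [PPState.init, NewsStream.visitsBefore]
  bounded := fun g q => by simp [PPState.init, StormState.init]
  active := fun g => le_rfl
  out := by simp [PPState.init]

theorem Sound.arrived {S : NewsStream d N} {k n : ℕ} {σ : PPState (Fin N)} (h : Sound S k n σ)
    (f : Finset (Fin N × ℕ) → ℝ) (tie : TieRule (Fin N)) (hk : 1 ≤ k) (hn : n < N) (g : ℕ) :
    (σ.arrived f tie k ⟨n, hn⟩ g).Bounded k fun v : Fin N => (v : ℕ) < n + 1 :=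
  (StormState.process_bounded f tie hk g (i := ⟨n, hn⟩) (p := fun v => (v : ℕ) < n + 1)
    (Nat.lt_succ_self n) fun q => ⟨(h.bounded g q).1, fun v hv =>
      ((h.bounded g q).2 v hv).trans (Nat.lt_succ_self n)⟩).1

theorem Sound.step {S : NewsStream d N} {k n : ℕ} {σ : PPState (Fin N)} (h : Sound S k n σ)
    (f : Finset (Fin N × ℕ) → ℝ) (tie : TieRule (Fin N)) (hk : 1 ≤ k) (G : Finset ℕ)
    (hn : n < N) :
    Sound S k (n + 1) (stormPPStep f tie k G σ ⟨n, hn⟩ (S.access ⟨n, hn⟩)).state := by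
  have hact : ∀ g, (σ.arrived f tie k ⟨n, hn⟩ g).active ⊆ Finset.Icc 1 g := fun g => by
    rw [PPState.arrived, (StormState.process_active f tie hk g _ _).1]
    exact h.active g
  have hresp := fun g => StormState.respond_bounded f tie g ⟨n, hn⟩ (h.arrived f tie hk hn g)
  by_cases hacc : S.access ⟨n, hn⟩ = true
  · rw [hacc, stormPPStep_state_true]
    refine ⟨?_, fun g => (hresp g).1, fun g => (hresp g).2.1.trans (hact g), ?_⟩
    · simp only [h.visits, S.visitsBefore_succ_of_access hn hacc]
    · intro t ht
      by_cases htv : t = σ.visits + 1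
      · subst htv
        simp only [Function.update_self]
        refine ⟨(hresp _).2.2.1, fun i hi => ⟨⟨n, hn⟩, ?_, ?_⟩⟩
        · rw [h.visits]
          exact S.isVisit_of_access hn hacc
        · exact Nat.lt_succ_iff.1 ((hresp _).2.2.2.1 i hi)
      · simp only [Function.update_of_ne htv]
        refine h.out t (Finset.mem_Icc.2 ?_)
        simp only [Finset.mem_Icc] at ht
        omega
  · rw [Bool.not_eq_true] at hacc
    rw [hacc, stormPPStep_state_false]
    refine ⟨?_, h.arrived f tie hk hn, hact, h.out⟩
    simp only [h.visits]
    rw [S.visitsBefore_succ_of_not_access hn (by simp [hacc])]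

theorem sound_stateAfter (S : NewsStream d N) (tie : TieRule (Fin N)) {k : ℕ} (hk : 1 ≤ k)
    (T' δ : ℕ) {n : ℕ} (hn : n ≤ N) : Sound S k n (stateAfter S tie k T' δ n) := by
  induction n with
  | zero => exact sound_init S k
  | succ n ih =>
    rw [stateAfter, dif_pos (Nat.lt_of_succ_le hn)]
    exact (ih (Nat.le_of_succ_le hn)).step _ tie hk _ _

theorem feasible_output (S : NewsStream d N) (tie : TieRule (Fin N)) {k : ℕ} (hk : 1 ≤ k)
    (T' δ : ℕ) : S.Feasible k (output S tie k T' δ) := by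
  have h := sound_stateAfter S tie hk T' δ le_rfl
  intro t ht
  refine h.out t ?_
  rwa [h.visits, S.visitsBefore_eq]

theorem Sound.words_le {S : NewsStream d N} {k n : ℕ} {σ : PPState (Fin N)} (h : Sound S k n σ)
    {G : Finset ℕ} {L T' : ℕ} (hL : ∀ g ∈ G, g ≤ L) (hT : S.numVisits ≤ T') :
    σ.words G ≤ G.card * (2 * (L * k) + L + 1) + 2 * (T' * k) + 1 := by
  have h1 : ∑ g ∈ G, (σ.copy g).words g ≤ G.card * (2 * (L * k) + L + 1) := by
    rw [← smul_eq_mul]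
    refine Finset.sum_le_card_nsmul _ _ _ fun g hg => ?_
    have h2 : ∑ q ∈ Finset.Icc 1 g, ((σ.copy g).cand q).card ≤ g * k := by
      simpa using Finset.sum_le_card_nsmul (Finset.Icc 1 g) _ k fun q _ => (h.bounded g q).1
    have h3 := hL g hg
    have h4 := Nat.mul_le_mul_right k h3
    rw [StormState.words]
    omega
  have h2 : ∑ t ∈ Finset.Icc 1 σ.visits, (σ.out t).card ≤ σ.visits * k := by
    simpa using Finset.sum_le_card_nsmul (Finset.Icc 1 σ.visits) _ k fun t ht => (h.out t ht).1
  have h3 : σ.visits * k ≤ T' * k :=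
    Nat.mul_le_mul_right k (h.visits ▸ (S.visitsBefore_le n).trans hT)
  rw [PPState.words]
  omega

theorem stepAt_state (S : NewsStream d N) (tie : TieRule (Fin N)) (k T' δ : ℕ) (i : Fin N) :
    (stepAt S tie k T' δ i).state = stateAfter S tie k T' δ (i + 1) := by
  rw [stateAfter, dif_pos i.2]
  rfl

theorem stepAt_calls (S : NewsStream d N) (tie : TieRule (Fin N)) {k : ℕ} (hk : 1 ≤ k)
    (T' δ : ℕ) {L : ℕ} (hL : ∀ g ∈ guesses T' δ, g ≤ L) (i : Fin N) :
    (stepAt S tie k T' δ i).calls ≤ (guesses T' δ).card * (L * (2 * k + 6) + 2) ∧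
      (stepAt S tie k T' δ i).response ≤ 2 * L + 2 * (guesses T' δ).card := by
  have h := sound_stateAfter S tie hk T' δ i.2.le
  refine stormPPStep_calls _ tie _ hk (p := fun v : Fin N => (v : ℕ) < i + 1)
    (Nat.lt_succ_self i) (fun g q => ?_) h.active hL _
  exact ⟨(h.bounded g q).1, fun v hv => ((h.bounded g q).2 v hv).trans (Nat.lt_succ_self i)⟩

end StormPP

/-! ### Size and number of the guesses -/

/-- The largest guess is below `T' + δ`, and `δ ≤ T'`. The same rounding bounds the number of
guesses by `T' / δ + 1 ≤ 2 * T' / δ`. -/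
theorem le_two_mul_of_mem_guesses {T' δ g : ℕ} (hδ : 1 ≤ δ) (hT : δ ≤ T') (hg : g ∈ guesses T' δ) :
    g ≤ 2 * T' := by
  obtain ⟨m, hm, rfl⟩ := Finset.mem_image.1 hg
  have hδ' : (0 : ℝ) < δ := by exact_mod_cast hδ
  have h1 : (m : ℝ) ≤ ⌈(T' : ℝ) / δ⌉₊ := by exact_mod_cast (Finset.mem_Icc.1 hm).2
  have h2 : (⌈(T' : ℝ) / δ⌉₊ : ℝ) < (T' : ℝ) / δ + 1 := Nat.ceil_lt_add_one (by positivity)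
  have h3 : (m : ℝ) * δ ≤ ((T' : ℝ) / δ + 1) * δ :=
    mul_le_mul_of_nonneg_right (h1.trans h2.le) hδ'.le
  rw [add_mul, div_mul_cancel₀ _ hδ'.ne', one_mul] at h3
  have h4 : (m : ℝ) * δ ≤ 2 * T' := by
    have : (δ : ℝ) ≤ T' := by exact_mod_cast hT
    linarith
  exact_mod_cast h4

theorem card_guesses_le {T' δ : ℕ} (hδ : 1 ≤ δ) (hT : δ ≤ T') :
    ((guesses T' δ).card : ℝ) ≤ 2 * T' / δ := by
  have hδ' : (0 : ℝ) < δ := by exact_mod_cast hδ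
  have h1 : (guesses T' δ).card ≤ ⌈(T' : ℝ) / δ⌉₊ := by
    rw [guesses]
    exact Finset.card_image_le.trans (by simp)
  have h1' : ((guesses T' δ).card : ℝ) ≤ ⌈(T' : ℝ) / δ⌉₊ := by exact_mod_cast h1
  have h2 : (⌈(T' : ℝ) / δ⌉₊ : ℝ) < (T' : ℝ) / δ + 1 := Nat.ceil_lt_add_one (by positivity)
  have h3 : (1 : ℝ) ≤ (T' : ℝ) / δ := by
    rw [one_le_div hδ']
    exact_mod_cast hT
  rw [mul_div_assoc]
  linarith

theorem guesses_nonempty {T' δ : ℕ} (hδ : 1 ≤ δ) (hT : δ ≤ T') : (guesses T' δ).Nonempty := by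
  refine Finset.Nonempty.image ⟨1, Finset.mem_Icc.2 ⟨le_rfl, ?_⟩⟩ _
  rw [Nat.one_le_ceil_iff]
  have h1 : (0 : ℝ) < δ := by exact_mod_cast hδ
  have h2 : (0 : ℝ) < T' := by exact_mod_cast lt_of_lt_of_le hδ hT
  positivity

/-- Some guess exceeds the number of accesses by less than `δ`. -/
theorem exists_guess {T T' δ : ℕ} (hδ : 1 ≤ δ) (hT : 1 ≤ T) (hTT' : T ≤ T') :
    ∃ g ∈ guesses T' δ, T ≤ g ∧ g < T + δ := by
  have hδ' : (0 : ℝ) < δ := by exact_mod_cast hδ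
  have hT0 : (0 : ℝ) < T := by exact_mod_cast hT
  refine ⟨⌈(T : ℝ) / δ⌉₊ * δ, Finset.mem_image.2 ⟨_, Finset.mem_Icc.2 ⟨?_, ?_⟩, rfl⟩, ?_, ?_⟩
  · rw [Nat.one_le_ceil_iff]
    positivity
  · refine Nat.ceil_mono ?_
    gcongr
  · have := mul_le_mul_of_nonneg_right (Nat.le_ceil ((T : ℝ) / δ)) hδ'.le
    rw [div_mul_cancel₀ _ hδ'.ne'] at this
    exact_mod_cast this
  · have h2 : (⌈(T : ℝ) / δ⌉₊ : ℝ) < (T : ℝ) / δ + 1 := Nat.ceil_lt_add_one (by positivity)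
    have h3 := mul_lt_mul_of_pos_right h2 hδ'
    rw [add_mul, div_mul_cancel₀ _ hδ'.ne', one_mul] at h3
    exact_mod_cast h3

/-! ### Complexity bounds -/

namespace StormPP

variable {d N : ℕ}

/-- The space, time and response time of Storm++ in terms of the number of guesses. -/
theorem complexity_le (S : NewsStream d N) (tie : TieRule (Fin N)) {k T' δ : ℕ} (hk : 1 ≤ k)
    (hδ : 1 ≤ δ) (hT : S.numVisits ≤ T') (hδT : δ ≤ T') :
    space S tie k T' δ ≤ 30 * ((guesses T' δ).card * (T' * k)) ∧
    time S tie k T' δ ≤ N * (18 * ((guesses T' δ).card * (T' * k))) ∧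
    responseTime S tie k T' δ ≤ 4 * T' + 2 * (guesses T' δ).card := by
  have hL : ∀ g ∈ guesses T' δ, g ≤ 2 * T' := fun g hg => le_two_mul_of_mem_guesses hδ hδT hg
  have hc : 1 ≤ (guesses T' δ).card := (guesses_nonempty hδ hδT).card_pos
  have hT1 : 1 ≤ T' := hδ.trans hδT
  have hTk : T' ≤ T' * k := Nat.le_mul_of_pos_right _ hk
  -- With `L = 2 * T'` and `1 ≤ T' ≤ T' * k`, the constant is `4 + 12 + 2`.
  have hcalls : ∀ i, (stepAt S tie k T' δ i).calls ≤ 18 * ((guesses T' δ).card * (T' * k)) := by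
    intro i
    refine (stepAt_calls S tie hk T' δ hL i).1.trans ?_
    rw [mul_left_comm 18]
    refine Nat.mul_le_mul_left _ ?_
    have : 2 * T' * (2 * k + 6) + 2 = 4 * (T' * k) + 12 * T' + 2 := by ring
    omega
  -- Each guess takes `4 + 2 + 1 = 7` multiples of `T' * k`; the presented sets add two, and the
  -- counter and the arriving item at most three. Together with the oracle answers, space gets `12 +
  -- 18 = 30`.
  have hwords : ∀ {n σ}, Sound S k n σ →
      σ.words (guesses T' δ) + 2 ≤ 12 * ((guesses T' δ).card * (T' * k)) := by
    intro n σ h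
    have h1 := h.words_le hL hT
    have h2 : (guesses T' δ).card * (2 * (2 * T' * k) + 2 * T' + 1) ≤
        (guesses T' δ).card * (7 * (T' * k)) := by
      refine Nat.mul_le_mul_left _ ?_
      have : 2 * (2 * T' * k) = 4 * (T' * k) := by ring
      omega
    have h3 : T' * k ≤ (guesses T' δ).card * (T' * k) := Nat.le_mul_of_pos_left _ hc
    rw [mul_left_comm _ 7] at h2
    omega
  refine ⟨?_, ?_, ?_⟩
  · refine max_le ?_ (Finset.sup_le fun i _ => ?_)
    · have := hwords (sound_init S k)
      omega
    · have h1 := hwords (stepAt_state S tie k T' δ i ▸ sound_stateAfter S tie hk T' δ i.2)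
      have h2 := hcalls i
      omega
  · simpa [time] using Finset.sum_le_card_nsmul Finset.univ _ _ fun i _ => hcalls i
  · refine Finset.sup_le fun i _ => ?_
    have := (stepAt_calls S tie hk T' δ hL i).2
    omega

/-! ### The competitive ratio -/

/-- The facts about the state of Storm++ after `n` time steps that compare its output with a
solution `A`, by way of the copy of Storm with parameter `g`. The `t`-th output of that copy is its
candidate set `J t`. -/
structure Competes (S : NewsStream d N) (k δ g : ℕ) (A : ℕ → Finset (Fin N)) (n : ℕ)
    (σ : PPState (Fin N)) (J : ℕ → ℕ) (D : Set (Fin N × ℕ)) : Prop where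
  injOn : Set.InjOn J (Finset.Icc 1 σ.visits)
  mem_Icc : ∀ t ∈ Finset.Icc 1 σ.visits, J t ∈ Finset.Icc 1 g
  notMem : ∀ t ∈ Finset.Icc 1 σ.visits, J t ∉ (σ.copy g).active
  card_active : (σ.copy g).active.card + σ.visits = g
  accounted : (σ.copy g).Accounted S.coverage k g D
  offered : ∀ j ∈ (σ.copy g).active, ∀ o : Fin N, (o : ℕ) < n → (o, j) ∈ D
  presented : ∀ t ∈ Finset.Icc 1 σ.visits, ∀ o ∈ A t, (o, J t) ∈ D
  -- The tags of the two families may clash, so the product of the misses stands for the value of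
  -- their disjoint union.
  greedy : ∑ c, (1 - S.miss c (copies (Finset.Icc 1 σ.visits) σ.out) *
      S.miss c ((σ.copy g).shown g)) ≤
    2 * S.coverage (copies (Finset.Icc 1 σ.visits) σ.out)
  shown : σ.visits = S.numVisits → S.value A ≤ 4 * δ * S.coverage ((σ.copy g).shown g)

theorem competes_init (S : NewsStream d N) (k δ g : ℕ) (A : ℕ → Finset (Fin N))
    (hT : 1 ≤ S.numVisits) (J : ℕ → ℕ) :
    Competes S k δ g A 0 (PPState.init (Fin N)) J ∅ where
  injOn := by simp [PPState.init]
  mem_Icc := by simp [PPState.init]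
  notMem := by simp [PPState.init]
  card_active := by simp [PPState.init, StormState.init]
  accounted := by
    have : ((PPState.init (Fin N)).copy g).pool g = ∅ := by
      ext x
      simp [StormState.mem_pool, PPState.init, StormState.init]
    exact ⟨∅, by rw [this], by rw [this, S.coverage_isMonotoneSubmodular.map_empty]; simp,
      by simp⟩
  offered := by simp
  presented := by simp [PPState.init]
  greedy := by
    simp [PPState.init, StormState.init, StormState.shown, copies, NewsStream.miss,
      NewsStream.coverage]
  shown := fun h => by
    have : (PPState.init (Fin N)).visits = 0 := rfl
    omega

theorem accounted_arrived {S : NewsStream d N} {k δ g n : ℕ} {A : ℕ → Finset (Fin N)}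
    {σ : PPState (Fin N)} {J : ℕ → ℕ} {D : Set (Fin N × ℕ)} (h : Competes S k δ g A n σ J D)
    (hs : Sound S k n σ) (tie : TieRule (Fin N)) (hk : 1 ≤ k) (hn : n < N) :
    (σ.arrived S.coverage tie k ⟨n, hn⟩ g).Accounted S.coverage k g
        (D ∪ {x | x.1 = ⟨n, hn⟩ ∧ x.2 ∈ (σ.copy g).active}) ∧
      ∀ j ∈ (σ.copy g).active, ∀ o : Fin N, (o : ℕ) < n + 1 →
        (o, j) ∈ D ∪ {x | x.1 = ⟨n, hn⟩ ∧ x.2 ∈ (σ.copy g).active} := by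
  refine ⟨h.accounted.process S.coverage_isMonotoneSubmodular tie hk (hs.active g)
    (hs.bounded g), fun j hj o ho => ?_⟩
  obtain ho | ho := Nat.lt_succ_iff_lt_or_eq.1 ho
  · exact Or.inl (h.offered j hj o ho)
  · exact Or.inr ⟨Fin.ext ho, hj⟩

theorem Competes.step_of_not_access {S : NewsStream d N} {k δ g n : ℕ}
    {A : ℕ → Finset (Fin N)} {σ : PPState (Fin N)} {J : ℕ → ℕ} {D : Set (Fin N × ℕ)}
    (h : Competes S k δ g A n σ J D) (hs : Sound S k n σ) (tie : TieRule (Fin N)) (hk : 1 ≤ k)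
    (G : Finset ℕ) (hn : n < N) :
    Competes S k δ g A (n + 1) (stormPPStep S.coverage tie k G σ ⟨n, hn⟩ false).state J
      (D ∪ {x | x.1 = ⟨n, hn⟩ ∧ x.2 ∈ (σ.copy g).active}) := by
  obtain ⟨h1, h2⟩ := accounted_arrived h hs tie hk hn
  have hact : (σ.arrived S.coverage tie k ⟨n, hn⟩ g).active = (σ.copy g).active :=
    (StormState.process_active _ tie hk g _ _).1
  have hsh : (σ.arrived S.coverage tie k ⟨n, hn⟩ g).shown g = (σ.copy g).shown g :=
    StormState.process_shown _ tie hk g _ _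
  rw [stormPPStep_state_false]
  refine ⟨h.injOn, h.mem_Icc, ?_, ?_, h1, ?_, fun t ht o ho => Or.inl (h.presented t ht o ho),
    ?_, ?_⟩ <;> simp only [hact, hsh]
  exacts [h.notMem, h.card_active, h2, h.greedy, h.shown]

/-- Following the best proposal keeps the value of the presented sets at least half the value of
the presented sets together with the outputs of a fixed copy of Storm. -/
theorem greedy_step (S : NewsStream d N) {H X Y Z : Finset (Fin N × ℕ)} {B : Finset (Fin N)}
    {j t : ℕ} (hX : Disjoint X H) (hB : Disjoint (B ×ˢ {t}) H) (hZ : Disjoint (B ×ˢ {j}) Z)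
    (h : ∑ c, (1 - S.miss c H * S.miss c Z) ≤ 2 * S.coverage H)
    (hXY : marginal S.coverage (B ×ˢ {t}) H ≤ marginal S.coverage X H)
    (hY : Y = X ∪ H) :
    ∑ c, (1 - S.miss c Y * S.miss c (B ×ˢ {j} ∪ Z)) ≤ 2 * S.coverage Y := by
  subst hY
  have h1 : ∑ c, (1 - S.miss c (X ∪ H) * S.miss c (B ×ˢ {j} ∪ Z)) ≤
      ∑ c, (1 - S.miss c H * S.miss c Z) + (marginal S.coverage X H +
        marginal S.coverage (B ×ˢ {t}) H) := by
    rw [S.marginal_coverage, S.marginal_coverage, Finset.sdiff_eq_self_of_disjoint hX,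
      Finset.sdiff_eq_self_of_disjoint hB, ← Finset.sum_add_distrib, ← Finset.sum_add_distrib]
    refine Finset.sum_le_sum fun c _ => ?_
    rw [S.miss_union c hX, S.miss_union c hZ, S.miss_product c B t j]
    have a0 := S.miss_nonneg c H
    have b0 := S.miss_nonneg c X
    have b1 := S.miss_le_one c X
    have c0 := S.miss_nonneg c (B ×ˢ {j})
    have c1 := S.miss_le_one c (B ×ˢ {j})
    have e1 := S.miss_le_one c Z
    generalize S.miss c H = a at *
    generalize S.miss c X = b at *
    generalize S.miss c (B ×ˢ {j}) = u at *
    generalize S.miss c Z = e at *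
    -- For one topic the joint value rises by `a * e * (1 - b * u)`. Here `e ≤ 1` is dropped, and `1
    -- - b * u ≤ (1 - b) + (1 - u)` separates the gains of the presented set and of the fixed copy's
    -- proposal.
    have h2 : e * (1 - b * u) ≤ 1 - b * u :=
      mul_le_of_le_one_left (sub_nonneg.2 (mul_le_one₀ b1 c0 c1)) e1
    have h3 := mul_nonneg (sub_nonneg.2 b1) (sub_nonneg.2 c1)
    have h4 : a * (e * (1 - b * u)) ≤ a * ((1 - b) + (1 - u)) :=
      mul_le_mul_of_nonneg_left (by linarith) a0
    linarith
  rw [marginal, marginal] at *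
  linarith

theorem Competes.step_of_access {S : NewsStream d N} {k δ g n : ℕ}
    {A : ℕ → Finset (Fin N)} {σ : PPState (Fin N)} {J : ℕ → ℕ} {D : Set (Fin N × ℕ)}
    (h : Competes S k δ g A n σ J D) (hs : Sound S k n σ) (tie : TieRule (Fin N)) (hk : 1 ≤ k)
    {G : Finset ℕ} (hgG : g ∈ G) (hg : S.numVisits ≤ g) (hgδ : g < S.numVisits + δ)
    (hA : S.Feasible k A) (hn : n < N) (hacc : S.access ⟨n, hn⟩ = true) :
    ∃ J' D', Competes S k δ g A (n + 1) (stormPPStep S.coverage tie k G σ ⟨n, hn⟩ true).state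
      J' D' := by
  obtain ⟨h1, h2⟩ := accounted_arrived h hs tie hk hn
  set D₁ := D ∪ {x | x.1 = ⟨n, hn⟩ ∧ x.2 ∈ (σ.copy g).active} with hD₁
  set s := σ.arrived S.coverage tie k ⟨n, hn⟩ g with hs'
  have hact : s.active = (σ.copy g).active := (StormState.process_active _ tie hk g _ _).1
  have hsh : s.shown g = (σ.copy g).shown g := StormState.process_shown _ tie hk g _ _
  have hf := S.coverage_isMonotoneSubmodular
  have hvis : σ.visits + 1 ≤ S.numVisits := by
    rw [hs.visits, ← S.visitsBefore_succ_of_access hn hacc]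
    exact S.visitsBefore_le _
  have hcard := h.card_active
  -- Fewer than `S.numVisits ≤ g` sets have been output so far, so the copy has not run out of
  -- active sets.
  have hne : s.active.Nonempty := by
    rw [hact, ← Finset.card_pos]
    omega
  obtain ⟨j, hj, hresp, hmax⟩ := StormState.respond_spec S.coverage tie g ⟨n, hn⟩ hne
  have hsub : s.active ⊆ Finset.Icc 1 g := hact ▸ hs.active g
  have hprop : σ.proposal S.coverage tie k ⟨n, hn⟩ g = s.cand j := by
    rw [PPState.proposal, ← hs', hresp]
  have hcopy : (stormPPStep S.coverage tie k G σ ⟨n, hn⟩ true).state.copy g =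
      { s with active := s.active.erase j } := by
    rw [stormPPStep_state_true]
    simp only [← hs', hresp]
  have hvisits : (stormPPStep S.coverage tie k G σ ⟨n, hn⟩ true).state.visits =
      σ.visits + 1 := rfl
  have hout : copies (Finset.Icc 1 (σ.visits + 1))
      (stormPPStep S.coverage tie k G σ ⟨n, hn⟩ true).state.out =
      σ.proposal S.coverage tie k ⟨n, hn⟩ (σ.chosen S.coverage tie k G ⟨n, hn⟩) ×ˢ
        {σ.visits + 1} ∪ copies (Finset.Icc 1 σ.visits) σ.out := copies_update_succ _ _ _
  have hcases : ∀ t ∈ Finset.Icc 1 (σ.visits + 1), t = σ.visits + 1 ∨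
      (t ≠ σ.visits + 1 ∧ t ∈ Finset.Icc 1 σ.visits) := by
    intro t ht
    simp only [Finset.mem_Icc] at ht ⊢
    omega
  have hjJ : ∀ t ∈ Finset.Icc 1 σ.visits, J t ≠ j := fun t ht e =>
    h.notMem t ht (by rw [e, ← hact]; exact hj)
  have hinj : Set.InjOn (Function.update J (σ.visits + 1) j)
      (Finset.Icc 1 (σ.visits + 1) : Finset ℕ) := by
    intro t ht u hu htu
    obtain rfl | ⟨ht', ht⟩ := hcases t ht <;> obtain rfl | ⟨hu', hu⟩ := hcases u hu
    · rfl
    · rw [Function.update_self, Function.update_of_ne hu'] at htu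
      exact absurd htu.symm (hjJ u hu)
    · rw [Function.update_self, Function.update_of_ne ht'] at htu
      exact absurd htu (hjJ t ht)
    · rw [Function.update_of_ne ht', Function.update_of_ne hu'] at htu
      exact h.injOn ht hu htu
  have hmem : ∀ t ∈ Finset.Icc 1 (σ.visits + 1),
      Function.update J (σ.visits + 1) j t ∈ Finset.Icc 1 g := by
    intro t ht
    obtain rfl | ⟨ht', ht⟩ := hcases t ht
    · rw [Function.update_self]
      exact hsub hj
    · rw [Function.update_of_ne ht']
      exact h.mem_Icc t ht
  have hpres : ∀ t ∈ Finset.Icc 1 (σ.visits + 1), ∀ o ∈ A t,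
      (o, Function.update J (σ.visits + 1) j t) ∈ D₁ := by
    intro t ht o ho
    obtain rfl | ⟨ht', ht⟩ := hcases t ht
    · rw [Function.update_self]
      -- Set `j` is active until this access, so it has been offered every item that a feasible
      -- solution may present here.
      refine h2 j (hact ▸ hj) o ?_
      obtain ⟨r, hr, hor⟩ := (hA _ (Finset.mem_Icc.2 ⟨by omega, hvis⟩)).2 o ho
      have hv := S.isVisit_of_access hn hacc
      rw [← hs.visits] at hv
      rw [hr.unique hv] at hor
      exact Nat.lt_succ_iff.2 hor
    · rw [Function.update_of_ne ht']
      exact Or.inl (h.presented t ht o ho)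
  refine ⟨Function.update J (σ.visits + 1) j, D₁, ?_⟩
  constructor
  · exact hinj
  · exact hmem
  · intro t ht
    rw [hcopy]
    obtain rfl | ⟨ht', ht⟩ := hcases t ht
    · simp
    · rw [Function.update_of_ne ht']
      exact fun hm => h.notMem t ht (hact ▸ Finset.mem_of_mem_erase hm)
  · rw [hcopy, hvisits]
    have := Finset.card_erase_add_one hj
    rw [hact] at this
    simp only [hact]
    omega
  · rw [hcopy]
    exact h1
  · rw [hcopy]
    exact fun q hq => h2 q (hact ▸ Finset.mem_of_mem_erase hq)
  · exact hpres
  · rw [hcopy, hvisits, StormState.shown_erase (hsub hj), copies_singleton]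
    refine greedy_step S (t := σ.visits + 1) (disjoint_copies_succ _ _ _)
      (disjoint_copies_succ _ _ _) ?_ (hsh.symm ▸ h.greedy) ?_ hout
    · refine Finset.disjoint_left.2 fun x hx hy => ?_
      simp only [StormState.shown, mem_copies, Finset.mem_product, Finset.mem_singleton,
        Finset.mem_sdiff] at hx hy
      exact hy.1.2 (hx.2.symm ▸ hj)
    · rw [← hprop]
      exact chosen_spec S.coverage tie k G σ ⟨n, hn⟩ ⟨g, hgG⟩ g hgG
  · rw [hcopy, hvisits]
    intro hT
    have h3 := h1.le_four_mul_pool hf (I := Finset.Icc 1 (σ.visits + 1)) (O := A) hinj hmem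
      (fun t ht => (hA t (hT ▸ ht)).1) hpres
    -- At the last access `g - (S.numVisits - 1)` sets are active, which is at most `δ` by `hgδ`.
    have h4 := StormState.pool_le_shown hf (δ := δ) hsub hj (by rw [hact]; omega) hmax
    -- The retagging is injective on the copies of the solution, so `h3` bounds its actual value.
    have h5 : Set.InjOn (fun x : Fin N × ℕ => (x.1, Function.update J (σ.visits + 1) j x.2))
        (copies (Finset.Icc 1 (σ.visits + 1)) A) := by
      intro x hx y hy hxy
      rw [Finset.mem_coe, mem_copies] at hx hy
      rw [Prod.mk.injEq] at hxy
      exact Prod.ext hxy.1 (hinj hx.1 hy.1 hxy.2)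
    rw [S.coverage_image h5 fun _ _ => rfl, hT] at h3
    rw [NewsStream.value]
    linarith

theorem competes_stateAfter (S : NewsStream d N) (tie : TieRule (Fin N)) {k T' δ g : ℕ}
    (hk : 1 ≤ k) (hgG : g ∈ guesses T' δ) (hT : 1 ≤ S.numVisits) (hg : S.numVisits ≤ g)
    (hgδ : g < S.numVisits + δ) {A : ℕ → Finset (Fin N)} (hA : S.Feasible k A) {n : ℕ}
    (hn : n ≤ N) : ∃ J D, Competes S k δ g A n (stateAfter S tie k T' δ n) J D := by
  induction n with
  | zero => exact ⟨id, ∅, competes_init S k δ g A hT id⟩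
  | succ n ih =>
    obtain ⟨J, D, h⟩ := ih (Nat.le_of_succ_le hn)
    have hs := sound_stateAfter S tie hk T' δ (Nat.le_of_succ_le hn)
    rw [stateAfter, dif_pos (Nat.lt_of_succ_le hn)]
    by_cases hacc : S.access ⟨n, Nat.lt_of_succ_le hn⟩ = true
    · rw [hacc]
      exact h.step_of_access hs tie hk hgG hg hgδ hA _ hacc
    · rw [Bool.not_eq_true] at hacc
      rw [hacc]
      exact ⟨_, _, h.step_of_not_access hs tie hk _ _⟩

theorem competitive (S : NewsStream d N) (tie : TieRule (Fin N)) {k T' δ : ℕ} (hk : 1 ≤ k)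
    (hδ : 1 ≤ δ) (hT : S.numVisits ≤ T') {A : ℕ → Finset (Fin N)} (hA : S.Feasible k A) :
    S.value A ≤ 8 * δ * S.value (output S tie k T' δ) := by
  obtain h0 | h0 := Nat.eq_zero_or_pos S.numVisits
  · simp [NewsStream.value, h0, copies, S.coverage_isMonotoneSubmodular.map_empty]
  · obtain ⟨g, hgG, hg, hgδ⟩ := exists_guess hδ h0 hT
    obtain ⟨J, D, h⟩ := competes_stateAfter S tie hk hgG h0 hg hgδ hA le_rfl
    have hv : (stateAfter S tie k T' δ N).visits = S.numVisits := by
      rw [(sound_stateAfter S tie hk T' δ le_rfl).visits, S.visitsBefore_eq]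
    have h1 := h.shown hv
    have h2 := h.greedy
    rw [hv] at h2
    have h3 : S.coverage (((stateAfter S tie k T' δ N).copy g).shown g) ≤
        2 * S.value (output S tie k T' δ) := by
      refine le_trans (Finset.sum_le_sum fun c _ => ?_) h2
      -- The outputs of copy `g` alone are worth no more than jointly with the presented sets.
      exact sub_le_sub_left (mul_le_of_le_one_left (S.miss_nonneg c _) (S.miss_le_one c _)) 1
    have h4 : (0 : ℝ) ≤ δ := Nat.cast_nonneg δ
    have := mul_le_mul_of_nonneg_left h3 h4
    linarith

end StormPP

end S3MOR

theorem theorem3 :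
    ∃ K : ℝ, ∀ (d N : ℕ) (S : S3MOR.NewsStream d N) (tie : S3MOR.TieRule (Fin N)) (k T' δ : ℕ),
      1 ≤ k → 1 ≤ δ → S.numVisits ≤ T' →
        S.Feasible k (S3MOR.StormPP.output S tie k T' δ) ∧
        (∀ A : ℕ → Finset (Fin N), S.Feasible k A →
          1 / (8 * (δ : ℝ)) * S.value A ≤ S.value (S3MOR.StormPP.output S tie k T' δ)) ∧
        (δ ≤ T' →
          (S3MOR.StormPP.space S tie k T' δ : ℝ) ≤ K * ((T' : ℝ) ^ 2 * k / δ) ∧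
          (S3MOR.StormPP.time S tie k T' δ : ℝ) ≤ K * (N * k * (T' : ℝ) ^ 2 / δ) ∧
          (S3MOR.StormPP.responseTime S tie k T' δ : ℝ) ≤ K * T') := by
  -- Space needs `30 * 2`, from at most `2 * T' / δ` guesses; time needs only `18 * 2`, and response
  -- time `4 + 2 * 2`.
  refine ⟨60, fun d N S tie k T' δ hk hδ hT =>
    ⟨S3MOR.StormPP.feasible_output S tie hk T' δ, fun A hA => ?_, fun hδT => ?_⟩⟩
  · have hδ' : (0 : ℝ) < 8 * δ := by
      have : (0 : ℝ) < δ := by exact_mod_cast hδ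
      linarith
    rw [one_div, inv_mul_le_iff₀ hδ']
    exact S3MOR.StormPP.competitive S tie hk hδ hT hA
  · obtain ⟨h1, h2, h3⟩ := S3MOR.StormPP.complexity_le S tie hk hδ hT hδT
    have hδ' : (1 : ℝ) ≤ δ := by exact_mod_cast hδ
    have hδ0 : (0 : ℝ) < δ := by linarith
    have hc := S3MOR.card_guesses_le hδ hδT
    have hT0 : (0 : ℝ) ≤ T' := Nat.cast_nonneg _
    have hck : ((S3MOR.guesses T' δ).card : ℝ) * (T' * k) ≤ 2 * ((T' : ℝ) ^ 2 * k / δ) := by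
      calc ((S3MOR.guesses T' δ).card : ℝ) * (T' * k) ≤ 2 * T' / δ * (T' * k) :=
            mul_le_mul_of_nonneg_right hc (by positivity)
        _ = 2 * ((T' : ℝ) ^ 2 * k / δ) := by ring
    refine ⟨?_, ?_, ?_⟩
    · have : (S3MOR.StormPP.space S tie k T' δ : ℝ) ≤
          30 * ((S3MOR.guesses T' δ).card * (T' * k)) := by exact_mod_cast h1
      linarith
    · have h4 : (S3MOR.StormPP.time S tie k T' δ : ℝ) ≤
          N * (18 * ((S3MOR.guesses T' δ).card * (T' * k))) := by exact_mod_cast h2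
      have h5 : (0 : ℝ) ≤ (T' : ℝ) ^ 2 * k / δ := by positivity
      calc (S3MOR.StormPP.time S tie k T' δ : ℝ) ≤ _ := h4
        _ ≤ N * (60 * ((T' : ℝ) ^ 2 * k / δ)) :=
            mul_le_mul_of_nonneg_left (by linarith) (Nat.cast_nonneg N)
        _ = 60 * (N * k * (T' : ℝ) ^ 2 / δ) := by ring
    · have h4 : (S3MOR.StormPP.responseTime S tie k T' δ : ℝ) ≤
          4 * T' + 2 * (S3MOR.guesses T' δ).card := by exact_mod_cast h3
      have h5 : 2 * (T' : ℝ) / δ ≤ 2 * T' := div_le_self (by positivity) hδ'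
      linarith
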